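/- **Theorem 1.4.** There exist absolute constants $C, c > 0$ with the following property. Let $X, X_1, X_2, \dots$ be independent identically distributed random variables with $\mathbb{E}X = 0$, $\operatorname{Var} X = 1$ and $\mathbb{E}\,e^{\alpha|X|} \le 2$ for some $\alpha > 0$. Put $Z_n = (X_1+\dots+X_n)/\sqrt n$, and assume that for some integer $n_0 \ge 1$ the random variable $Z_{n_0}$ has a density bounded by $M$. Set $$n_1 = C M^4 n_0^2\,\alpha^{-12}, \qquad \tau_0 = \frac{c\,\alpha^3}{M^2 n_0}.$$ Let $K(z) = \log \mathbb{E}\,e^{zX}$ (principal branch, $|z| \le \alpha/2$). (i) For every complex $\tau$ with $|\tau| \le \tau_0$ the equation $K'(z) = \tau$ has a unique solution $z_0(\tau)$ in the disc $|z| \le \alpha^3/16$. The functions $$\lambda(\tau) = \frac{1}{\tau^3}\Big(K(z_0(\tau)) - \tau z_0(\tau) + \tfrac12\tau^2\Big), \qquad \mu(\tau) = \tfrac12 \log K''(z_0(\tau))$$ (with the removable singularity of $\lambda$ at $\tau=0$ filled in) are analytic in the disc $|\tau| \le \tau_0$ and $\mu(0) = 0$. In this disc, $\lambda$ is the sum of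 its Taylor series at $0$ (Cramér's series). (ii) For every integer $n \ge n_1$, the random variable $Z_n$ has a continuous bounded density $p_n$. For all real $x$ such that $\tau = x/\sqrt n$ satisfies $|\tau| \le \tau_0$, $$\frac{p_n(x)}{\varphi(x)} = \exp\{n\tau^3\lambda(\tau) - \mu(\tau)\}\Big(1 + B\,\alpha^{-6}\,\frac{(\log n)^3}{n}\Big)$$ with some real $B$ such that $|B| \le C$, where $\varphi(x) = \frac{1}{\sqrt{2\pi}}e^{-x^2/2}$. -/

import Mathlib

open MeasureTheory ProbabilityTheory

namespace LocalLimit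

noncomputable section

/-- `q` is a (pointwise defined, non-negative) Lebesgue density of the measure `ν` on `ℝ`. -/
def IsDensity (ν : Measure ℝ) (q : ℝ → ℝ) : Prop :=
  Measurable q ∧ (∀ x, 0 ≤ q x) ∧ ν = volume.withDensity (fun x => ENNReal.ofReal (q x))

/-- The normalized sum `Z_n = (X_1 + ⋯ + X_n) / √n`; the summands are indexed from `0`. -/
def normalizedSum {Ω : Type*} (X : ℕ → Ω → ℝ) (n : ℕ) (ω : Ω) : ℝ :=
  (∑ i ∈ Finset.range n, X i ω) / Real.sqrt n

variable {Ω : Type*} [MeasurableSpace Ω]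

/-- The log-Laplace transform `K(z) = log E e^{zX}` of a complex variable. The principal branch is
the right one where it is used: if `E e^{α|X|} ≤ 2`, then `|E e^{zX} - 1| < 1` for `|z| ≤ α/2`. -/
def logLaplace (X : Ω → ℝ) (P : Measure Ω) (z : ℂ) : ℂ :=
  Complex.log (complexMGF X P z)

/-- `z` is a saddle point for `τ`: a solution of `K'(z) = τ` in the disc `|z| ≤ α³/16`. -/
def IsSaddlePoint (X : Ω → ℝ) (P : Measure Ω) (α : ℝ) (τ z : ℂ) : Prop :=
  ‖z‖ ≤ α ^ 3 / 16 ∧ deriv (logLaplace X P) z = τ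

/-- The saddle point `z₀(τ)` (an arbitrary value where there is none). -/
def saddlePoint (X : Ω → ℝ) (P : Measure Ω) (α : ℝ) (τ : ℂ) : ℂ :=
  Classical.epsilon (IsSaddlePoint X P α τ)

/-- `ψ(τ) = K(z₀(τ)) - τ z₀(τ) + τ²/2`. -/
def saddleValue (X : Ω → ℝ) (P : Measure Ω) (α : ℝ) (τ : ℂ) : ℂ :=
  logLaplace X P (saddlePoint X P α τ) - τ * saddlePoint X P α τ + τ ^ 2 / 2

/-- The function `λ(τ) = τ⁻³ (K(z₀(τ)) - τ z₀(τ) + τ²/2)`, extended to `τ = 0` by the third Taylor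
coefficient of the bracket (the removable singularity). Its Taylor series at `0` is Cramér's
series. -/
def cramer (X : Ω → ℝ) (P : Measure Ω) (α : ℝ) (τ : ℂ) : ℂ :=
  open Classical in
  if τ = 0 then iteratedDeriv 3 (saddleValue X P α) 0 / 6 else saddleValue X P α τ / τ ^ 3

/-- The function `μ(τ) = ½ log K''(z₀(τ))` (principal branch). -/
def muFun (X : Ω → ℝ) (P : Measure Ω) (α : ℝ) (τ : ℂ) : ℂ :=
  Complex.log (iteratedDeriv 2 (logLaplace X P) (saddlePoint X P α τ)) / 2

end

end LocalLimit

/-!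
The density `p_n` of `Z_n` is recovered from the Laplace transform `f(z) = E e^{zX}` by Fourier
inversion along a vertical line `Re z = h`. With `x = √n τ` this reads
`p_n(x) = e^{-nτh} f(h)^n (2π)⁻¹ ∫ (f(h + it/√n) / f(h))^n e^{-it√nτ} dt`, and `h` is chosen as the
saddle point `K'(h) = τ` of `K = log f`, so that the linear term of the exponent disappears.

*Saddle point.* The moment condition `E e^{α|X|} ≤ 2` gives `|K| ≤ 1` on `|z| ≤ α/2` and
`|K'' - 1| ≤ 1/2` on `|z| ≤ α³/16`
(`LocalLimit.IsStandardized.norm_deriv_deriv_logLaplace_sub_one_le`). So `K'` is a perturbation of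
the identity, `z₀(τ)` exists, is unique and is holomorphic in `τ`, and it is real for real `τ`, by
conjugation symmetry. The function `K(z₀(τ)) - τ z₀(τ) + τ²/2` has derivative `τ - z₀(τ)` and hence
a zero of order three at the origin, which makes `λ` holomorphic.

*Small frequencies.* For `|t| ≤ α³ √n / 1024`, Taylor's formula of order four with Cauchy's
estimates writes the integrand as `e^{-K''(h) t²/2} (1 + a t³)` up to an error of order
`α⁻⁶ n⁻¹` times an integrable function (`LocalLimit.IsStandardized.exists_norm_exp_sub_le`). The
cubic term is odd and integrates to zero, so the main term is the Gaussian integral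
`√(2π / K''(h))`, which produces `e^{-μ(τ)}`.

*Large frequencies.* The law of `Z_{n₀}` has a density bounded by `M`. By Plancherel's theorem the
tilted characteristic function `g(s) = f(h + is) / f(h)` satisfies `∫ |g|^{2 n₀} = O(M)`
(`LocalLimit.IsIIDWithDensity.integral_norm_tiltedCharFun_pow_le`); and a bounded density cannot
concentrate near an arithmetic progression, so `|g(s)|^{n₀} ≤ exp(-δ² / (12000 M²))` for
`|s| ≥ δ`, where `δ ≤ 1` (from `LocalLimit.norm_complexMGF_le_of_density`). The remaining
`n - 2 n₀` factors then make the tail of order `M √n e^{-√n}` as soon as `n ≥ C M⁴ n₀² α⁻¹²`. The resulting relative error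
is `O(α⁻⁶ / n)`, without a logarithmic factor.
-/

namespace LocalLimit

/-! ### Fourier inversion and Plancherel's theorem on the line -/

section

open Complex FourierTransform SchwartzMap

/-- The Fourier transform is self-adjoint for the bilinear pairing on `L¹`. -/
lemma integral_fourier_mul_eq {f g : ℝ → ℂ} (hf : Integrable f) (hg : Integrable g) :
    ∫ x, 𝓕 f x * g x = ∫ x, f x * 𝓕 g x := by
  have := VectorFourier.integral_bilin_fourierIntegral_eq_flip (μ := (volume : Measure ℝ))
    (ν := (volume : Measure ℝ)) (L := innerₗ ℝ)
    (ContinuousLinearMap.mul ℂ ℂ) Real.continuous_fourierChar (by fun_prop) hf hg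
  simpa using! this

/-- Two locally integrable functions are a.e. equal if they pair equally with Schwartz functions. -/
lemma ae_eq_of_integral_schwartz_mul_eq {f g : ℝ → ℂ} (hf : LocallyIntegrable f)
    (hg : LocallyIntegrable g) (h : ∀ u : 𝓢(ℝ, ℂ), ∫ x, u x * f x = ∫ x, u x * g x) :
    f =ᵐ[volume] g := by
  refine ae_eq_of_integral_contDiff_smul_eq hf hg fun u hu hu' => ?_
  have hc : HasCompactSupport (fun x => (u x : ℂ)) := hu'.comp_left (g := fun y : ℝ => (y : ℂ)) rfl
  have := h (hc.toSchwartzMap (ofRealCLM.contDiff.comp hu))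
  simpa [HasCompactSupport.toSchwartzMap] using! this

/-- Almost everywhere Fourier inversion for integrable functions with integrable transform. -/
lemma fourierInv_fourier_ae_eq {g : ℝ → ℂ} (hg : Integrable g) (hg' : Integrable (𝓕 g)) :
    𝓕⁻ (𝓕 g) =ᵐ[volume] g := by
  have hc : Continuous (𝓕⁻ (𝓕 g)) := by
    rw [Real.fourierInv_eq_fourier_comp_neg]
    exact VectorFourier.fourierIntegral_continuous Real.continuous_fourierChar (by fun_prop)
      hg'.comp_neg
  refine ae_eq_of_integral_schwartz_mul_eq hc.locallyIntegrable hg.locallyIntegrable fun u => ?_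
  have h1 : ∀ x, 𝓕⁻ (𝓕 g) x = 𝓕 (fun y => 𝓕 g (-y)) x := by
    intro x; rw [Real.fourierInv_eq_fourier_comp_neg]
  have h2 : ∀ x, u x = 𝓕 (⇑(𝓕⁻ u : 𝓢(ℝ, ℂ))) x := by
    intro x
    have : 𝓕 (𝓕⁻ u) x = u x := by rw [FourierInvPair.fourier_fourierInv_eq]
    rw [← this, fourier_coe]
  have h3 : ∀ x, (𝓕⁻ u) (-x) = 𝓕 (⇑u) x := by
    intro x
    rw [fourierInv_coe, Real.fourierInv_eq_fourier_neg, neg_neg]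
  simp_rw [h1]
  rw [← integral_fourier_mul_eq u.integrable hg'.comp_neg]
  have h4 : ∫ x, 𝓕 (⇑u) x * 𝓕 g (-x) = ∫ x, (𝓕⁻ u) x * 𝓕 g x := by
    rw [← integral_neg_eq_self]
    simp_rw [← h3, neg_neg]
  rw [h4, ← integral_fourier_mul_eq (𝓕⁻ u).integrable hg]
  simp_rw [← h2]

/-- Plancherel's theorem for the integral Fourier transform on `L¹ ∩ L²`. -/
lemma plancherel {g : ℝ → ℂ} (hg : Integrable g) (hg2 : MemLp g 2) :
    Integrable (fun w => ‖𝓕 g w‖ ^ 2) ∧ ∫ w, ‖𝓕 g w‖ ^ 2 = ∫ x, ‖g x‖ ^ 2 := by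
  have hc : Continuous (𝓕 g) :=
    VectorFourier.fourierIntegral_continuous Real.continuous_fourierChar (by fun_prop) hg
  set G : Lp ℂ 2 (volume : Measure ℝ) := 𝓕 (hg2.toLp g) with hG
  have hae : 𝓕 g =ᵐ[volume] G := by
    refine ae_eq_of_integral_schwartz_mul_eq hc.locallyIntegrable
      ((Lp.memLp G).locallyIntegrable (by norm_num)) fun u => ?_
    have h1 := congrArg (fun T => T u) (Lp.fourier_toTemperedDistribution_eq (hg2.toLp g))
    erw [TemperedDistribution.fourier_apply] at h1
    simp only [Lp.toTemperedDistribution_apply] at h1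
    rw [← integral_fourier_mul_eq u.integrable hg]
    simp only [smul_eq_mul] at h1
    rw [← hG] at h1
    rw [← h1]
    refine integral_congr_ae ?_
    filter_upwards [hg2.coeFn_toLp] with x hx
    rw [hx, fourier_coe]
  have hm : MemLp (𝓕 g) 2 := (memLp_congr_ae hae).mpr (Lp.memLp G)
  refine ⟨(memLp_two_iff_integrable_sq_norm hm.1).mp hm, ?_⟩
  have h2 : hm.toLp (𝓕 g) = G := by
    apply Lp.ext; exact hm.coeFn_toLp.trans hae
  have key : ∀ {f : ℝ → ℂ} (hf : MemLp f 2), ∫ x, ‖f x‖ ^ 2 = ‖hf.toLp f‖ ^ 2 := by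
    intro f hf
    have h : ((‖hf.toLp f‖ ^ 2 : ℝ) : ℂ) = ((∫ x, ‖f x‖ ^ 2 : ℝ) : ℂ) := by
      push_cast
      rw [← coe_algebraMap, ← inner_self_eq_norm_sq_to_K (𝕜 := ℂ), L2.inner_def,
        show (algebraMap ℝ ℂ) (∫ x, ‖f x‖ ^ 2) = ∫ x, ((‖f x‖ ^ 2 : ℝ) : ℂ) from
          integral_ofReal.symm]
      refine integral_congr_ae ?_
      filter_upwards [hf.coeFn_toLp] with x hx
      rw [hx, inner_self_eq_norm_sq_to_K]
      simp
    exact_mod_cast h.symm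
  rw [key hm, key hg2, h2, hG, Lp.norm_fourier_eq]

/-- **Fourier inversion for measures.** An absolutely continuous probability measure on `ℝ` with
integrable characteristic function has a continuous bounded density, given by the inversion
integral. -/
lemma exists_density_of_integrable_charFun {m : Measure ℝ} [IsProbabilityMeasure m]
    (hac : m ≪ volume) (hint : Integrable (charFun m)) :
    ∃ p : ℝ → ℝ, IsDensity m p ∧ Continuous p ∧ (∃ D, ∀ x, p x ≤ D) ∧
      ∀ x : ℝ, (p x : ℂ) = (2 * Real.pi)⁻¹ * ∫ t : ℝ, cexp (-(t * x * I)) * charFun m t := by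
  set g : ℝ → ℝ := fun x => (m.rnDeriv volume x).toReal with hgdef
  have hm : m = volume.withDensity (fun x => ENNReal.ofReal (g x)) := by
    conv_lhs => rw [← Measure.withDensity_rnDeriv_eq m volume hac]
    refine withDensity_congr_ae ?_
    filter_upwards [m.rnDeriv_lt_top volume] with x hx
    simp [hgdef, ENNReal.ofReal_toReal hx.ne]
  have hgm : Measurable g := (Measure.measurable_rnDeriv _ _).ennreal_toReal
  have hg0 : ∀ x, 0 ≤ g x := fun x => ENNReal.toReal_nonneg
  have hg : Integrable (fun x => (g x : ℂ)) := Measure.integrable_toReal_rnDeriv.ofReal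
  have hF : ∀ w, 𝓕 (fun x => (g x : ℂ)) w = charFun m (-2 * Real.pi * w) := by
    intro w
    rw [Real.fourier_real_eq_integral_exp_smul, charFun_apply_real]
    conv_rhs => rw [hm]
    rw [integral_withDensity_eq_integral_toReal_smul (by fun_prop) (by simp)]
    refine integral_congr_ae (.of_forall fun x => ?_)
    simp only [ENNReal.toReal_ofReal (hg0 x), real_smul, smul_eq_mul, ofReal_mul, ofReal_neg,
      ofReal_ofNat]
    rw [mul_comm]
    congr 2
    ring
  have hFi : Integrable (𝓕 (fun x => (g x : ℂ))) := by
    simp_rw [show 𝓕 (fun x => (g x : ℂ)) = fun w => charFun m (-2 * Real.pi * w) from funext hF]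
    exact hint.comp_mul_left' (by simp [Real.pi_ne_zero])
  have hae := fourierInv_fourier_ae_eq hg hFi
  set P : ℝ → ℂ := 𝓕⁻ (𝓕 (fun x => (g x : ℂ))) with hP
  have hPc : Continuous P := by
    rw [hP, Real.fourierInv_eq_fourier_comp_neg]
    exact VectorFourier.fourierIntegral_continuous Real.continuous_fourierChar (by fun_prop)
      hFi.comp_neg
  have hPx : ∀ x : ℝ, P x = (2 * Real.pi)⁻¹ * ∫ t : ℝ, cexp (-(t * x * I)) * charFun m t := by
    intro x
    have h1 : P x = ∫ t : ℝ,
        (fun s : ℝ => cexp (-(s * x * I)) * charFun m s) (-2 * Real.pi * t) := by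
      rw [hP, Real.fourierInv_eq']
      refine integral_congr_ae (.of_forall fun t => ?_)
      simp only [smul_eq_mul, hF]
      congr 2
      simp
      ring
    rw [h1, Measure.integral_comp_mul_left (fun s : ℝ => cexp (-(s * x * I)) * charFun m s),
      abs_inv, abs_mul, abs_neg, abs_two, abs_of_pos Real.pi_pos, real_smul]
  -- the inversion integral agrees a.e. with a non-negative function, hence, being continuous, it is
  -- real and non-negative everywhere
  set p : ℝ → ℝ := fun x => max (P x).re 0
  have hpc : Continuous p := by fun_prop
  have hpP : ∀ x, (p x : ℂ) = P x := by
    have : (fun x => (p x : ℂ)) =ᵐ[volume] P := by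
      filter_upwards [hae] with x hx
      simp [p, hx, hg0 x]
    exact congrFun
      ((by fun_prop : Continuous (fun x => (p x : ℂ))).ae_eq_iff_eq volume hPc |>.mp this)
  refine ⟨p, ⟨hpc.measurable, fun x => le_max_right _ _, ?_⟩, hpc, ?_, fun x => by rw [hpP, hPx]⟩
  · rw [hm]
    refine withDensity_congr_ae ?_
    filter_upwards [hae] with x hx
    simp [p, hx, hg0 x]
  · refine ⟨(2 * Real.pi)⁻¹ * ∫ t : ℝ, ‖charFun m t‖, fun x => ?_⟩
    have : p x ≤ ‖(p x : ℂ)‖ := by rw [norm_real]; exact le_abs_self _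
    refine this.trans ?_
    rw [hpP, hPx, norm_mul]
    have h0 : (0:ℝ) < 2 * Real.pi := by positivity
    gcongr
    · rw [norm_real, Real.norm_of_nonneg (by positivity)]
    · refine (norm_integral_le_integral_norm _).trans_eq ?_
      congr with t
      rw [norm_mul, norm_exp]
      simp

end

/-! ### Laws with a bounded density -/

section

open Complex FourierTransform

lemma IsDensity.integrable_iff {m : Measure ℝ} {q : ℝ → ℝ} (hq : IsDensity m q) {f : ℝ → ℂ} :
    Integrable f m ↔ Integrable (fun x => (q x : ℂ) * f x) := by
  obtain ⟨h1, h2, h3⟩ := hq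
  rw [h3, integrable_withDensity_iff_integrable_smul' (by fun_prop) (by simp)]
  simp [ENNReal.toReal_ofReal (h2 _)]

lemma IsDensity.integral_eq {m : Measure ℝ} {q : ℝ → ℝ} (hq : IsDensity m q) (f : ℝ → ℂ) :
    ∫ x, f x ∂m = ∫ x, (q x : ℂ) * f x := by
  obtain ⟨h1, h2, h3⟩ := hq
  rw [h3, integral_withDensity_eq_integral_toReal_smul (by fun_prop) (by simp)]
  simp [ENNReal.toReal_ofReal (h2 _)]

lemma IsDensity.integral_eq_real {m : Measure ℝ} {q : ℝ → ℝ} (hq : IsDensity m q) (f : ℝ → ℝ) :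
    ∫ x, f x ∂m = ∫ x, q x * f x := by
  obtain ⟨h1, h2, h3⟩ := hq
  rw [h3, integral_withDensity_eq_integral_toReal_smul (by fun_prop) (by simp)]
  simp [ENNReal.toReal_ofReal (h2 _)]

/-- Plancherel's theorem along the vertical line through `h`: the transform there is the Fourier
transform of the tilted density `e^{hx} q(x)`, and `q² ≤ M q`. -/
lemma integral_complexMGF_sq_le {m : Measure ℝ} {q : ℝ → ℝ} {M h : ℝ}
    (hq : IsDensity m q) (hM : ∀ x, q x ≤ M)
    (h1 : Integrable (fun x => Real.exp (h * x)) m)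
    (h2 : Integrable (fun x => Real.exp (2 * h * x)) m) :
    Integrable (fun t : ℝ => ‖complexMGF id m (h + t * I)‖ ^ 2) ∧
      ∫ t : ℝ, ‖complexMGF id m (h + t * I)‖ ^ 2 ≤ 2 * Real.pi * M * mgf id m (2 * h) := by
  set u : ℝ → ℂ := fun x => q x * (Real.exp (h * x) : ℝ) with hu
  have hqm := hq.1
  have hu1 : Integrable u := hq.integrable_iff.mp h1.ofReal
  have hn : ∀ x, ‖u x‖ ^ 2 = q x * (q x * Real.exp (2 * h * x)) := by
    intro x
    rw [hu, norm_mul, norm_real, norm_real, mul_pow, Real.norm_eq_abs, sq_abs, Real.norm_eq_abs,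
      sq_abs, ← Real.exp_nat_mul]
    push_cast
    rw [← mul_assoc 2 h x]
    ring
  have hi2 : Integrable (fun x => q x * Real.exp (2 * h * x)) := by
    refine (hq.integrable_iff.mp h2.ofReal).re.congr (.of_forall fun x => ?_)
    simp [← ofReal_mul, -ofReal_exp]
  have hi3 : Integrable (fun x => ‖u x‖ ^ 2) := by
    refine (hi2.const_mul M).mono' (by fun_prop) (.of_forall fun x => ?_)
    rw [Real.norm_of_nonneg (by positivity), hn]
    exact mul_le_mul_of_nonneg_right (hM x) (mul_nonneg (hq.2.1 x) (Real.exp_pos _).le)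
  have hum : MemLp u 2 := (memLp_two_iff_integrable_sq_norm hu1.1).mpr hi3
  obtain ⟨p1, p2⟩ := plancherel hu1 hum
  have hF : ∀ w : ℝ, 𝓕 u w = complexMGF id m (h + ((-2 * Real.pi) * w : ℝ) * I) := by
    intro w
    rw [Real.fourier_real_eq_integral_exp_smul, complexMGF, hq.integral_eq]
    refine integral_congr_ae (.of_forall fun x => ?_)
    simp only [hu, smul_eq_mul, id]
    rw [mul_left_comm, ofReal_exp, ← Complex.exp_add]
    push_cast
    ring_nf
  have h3 : ∫ w, ‖𝓕 u w‖ ^ 2 ≤ M * mgf id m (2 * h) := by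
    rw [p2, mgf]
    simp only [id]
    rw [hq.integral_eq_real, ← integral_const_mul]
    refine integral_mono hi3 (hi2.const_mul M) fun x => ?_
    simp only [hn]
    exact mul_le_mul_of_nonneg_right (hM x) (mul_nonneg (hq.2.1 x) (Real.exp_pos _).le)
  simp_rw [hF] at p1 h3
  have hne : (-2 * Real.pi) ≠ 0 := by simp [Real.pi_ne_zero]
  refine ⟨(integrable_comp_mul_left_iff
    (fun t : ℝ => ‖complexMGF id m (h + t * I)‖ ^ 2) hne).mp p1, ?_⟩
  rw [Measure.integral_comp_mul_left (fun t : ℝ => ‖complexMGF id m (h + t * I)‖ ^ 2), abs_inv,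
    abs_mul, abs_neg, abs_two, abs_of_pos Real.pi_pos, smul_eq_mul,
    inv_mul_le_iff₀ (by positivity)] at h3
  linarith

/-- A bound for one period of `cos ^ (2 k)`, by comparison with a Gaussian. -/
lemma integral_cos_pow_le (k : ℕ) (hk : 0 < k) :
    ∫ v in (-(Real.pi / 2))..(Real.pi / 2), Real.cos v ^ (2 * k) ≤
      Real.pi / 2 * √(Real.pi / k) := by
  have hk' : (0:ℝ) < k := by exact_mod_cast hk
  have hpi := Real.pi_pos
  set b : ℝ := 4 * k / Real.pi ^ 2 with hb
  have hb0 : 0 < b := by positivity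
  have hle : ∀ v ∈ Set.Icc (-(Real.pi / 2)) (Real.pi / 2),
      Real.cos v ^ (2 * k) ≤ Real.exp (-b * v ^ 2) := by
    intro v hv
    have h1 := Real.mul_abs_le_abs_sin (abs_le.mpr hv)
    have h2 : (2 / Real.pi * |v|) ^ 2 ≤ Real.sin v ^ 2 := by
      rw [← sq_abs (Real.sin v)]; gcongr
    have h3 : Real.cos v ^ 2 ≤ Real.exp (-(4 / Real.pi ^ 2 * v ^ 2)) := by
      have := Real.add_one_le_exp (-(4 / Real.pi ^ 2 * v ^ 2))
      have h4 := Real.sin_sq_add_cos_sq v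
      rw [mul_pow, sq_abs, div_pow] at h2
      linarith
    rw [pow_mul]
    calc (Real.cos v ^ 2) ^ k ≤ (Real.exp (-(4 / Real.pi ^ 2 * v ^ 2))) ^ k := by gcongr
      _ = _ := by rw [← Real.exp_nat_mul]; congr 1; rw [hb]; ring
  calc _ ≤ ∫ v in (-(Real.pi / 2))..(Real.pi / 2), Real.exp (-b * v ^ 2) := by
        refine intervalIntegral.integral_mono_on (by linarith)
          (Continuous.intervalIntegrable (by fun_prop) _ _)
          (Continuous.intervalIntegrable (by fun_prop) _ _) hle
    _ ≤ ∫ v, Real.exp (-b * v ^ 2) := by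
        rw [intervalIntegral.integral_of_le (by linarith)]
        exact setIntegral_le_integral (integrable_exp_neg_mul_sq hb0)
          (.of_forall fun x => (Real.exp_pos _).le)
    _ = √(Real.pi / b) := integral_gaussian b
    _ = Real.pi / 2 * √(Real.pi / k) := by
        rw [show Real.pi / b = (Real.pi / 2) ^ 2 * (Real.pi / k) by rw [hb]; field_simp; ring,
          Real.sqrt_mul (by positivity), Real.sqrt_sq (by positivity)]

/-- Uniformly in the phase, `cos ^ (2 k)` has a small integral over `[-2, 2]`: the interval is
covered by at most `4 t / π + 1` periods. -/
lemma integral_cos_affine_pow_le {t : ℝ} (ht : 0 < t) (θ : ℝ) (k : ℕ) (hk : 0 < k) :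
    ∫ y in (-2)..2, Real.cos (t * y - θ) ^ (2 * k) ≤ (2 + Real.pi / (2 * t)) * √(Real.pi / k) := by
  have hpi := Real.pi_pos
  set w : ℝ → ℝ := fun v => Real.cos v ^ (2 * k) with hw
  have hw0 : ∀ v, 0 ≤ w v := fun v => by rw [hw]; exact (even_two_mul k).pow_nonneg _
  have hwi : ∀ a b, IntervalIntegrable w volume a b := fun a b =>
    Continuous.intervalIntegrable (by fun_prop) _ _
  have hper : Function.Periodic w Real.pi := by
    intro v; simp only [hw, Real.cos_add_pi]; exact (even_two_mul k).neg_pow _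
  set N : ℕ := ⌈4 * t / Real.pi⌉₊ with hN
  have hN1 : 4 * t ≤ N * Real.pi := by
    rw [← div_le_iff₀ hpi]; exact Nat.le_ceil _
  have hN2 : (N : ℝ) ≤ 4 * t / Real.pi + 1 := (Nat.ceil_lt_add_one (by positivity)).le
  have hJ := integral_cos_pow_le k hk
  have h1 : ∫ y in (-2)..2, w (t * y - θ) = t⁻¹ * ∫ v in (t * (-2) - θ)..(t * 2 - θ), w v := by
    rw [intervalIntegral.integral_comp_mul_sub w ht.ne', smul_eq_mul]
  have h2 : ∫ v in (t * (-2) - θ)..(t * 2 - θ), w v ≤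
      ∫ v in (t * (-2) - θ)..(t * (-2) - θ + (N : ℤ) • Real.pi), w v := by
    refine intervalIntegral.integral_mono_interval le_rfl (by linarith) ?_
      (.of_forall hw0) (hwi _ _)
    simp only [zsmul_eq_mul, Int.cast_natCast]; linarith
  rw [hper.intervalIntegral_add_zsmul_eq _ _ (hwi · ·),
    hper.intervalIntegral_add_eq _ (-(Real.pi / 2)),
    show -(Real.pi / 2) + Real.pi = Real.pi / 2 by ring] at h2
  simp only [zsmul_eq_mul, Int.cast_natCast] at h2
  change ∫ y in (-2)..2, w (t * y - θ) ≤ _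
  rw [h1]
  calc t⁻¹ * _ ≤ t⁻¹ * ((4 * t / Real.pi + 1) * (Real.pi / 2 * √(Real.pi / k))) := by
        gcongr
        exact h2.trans (mul_le_mul hN2 hJ
          (intervalIntegral.integral_nonneg (by linarith) fun v _ => hw0 v) (by positivity))
    _ = _ := by field_simp; ring

/-- Bernoulli's inequality turned into a lower bound for `sin²`. -/
lemma one_sub_cos_pow_le (v : ℝ) (k : ℕ) :
    1 - Real.cos v ^ (2 * k) ≤ k * Real.sin v ^ 2 := by
  have h := one_add_mul_le_pow (a := -Real.sin v ^ 2) (by nlinarith [Real.sin_sq_le_one v]) k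
  have h2 : (1 + -Real.sin v ^ 2) = Real.cos v ^ 2 := by
    have := Real.sin_sq_add_cos_sq v; linarith
  rw [h2, ← pow_mul] at h
  linarith

/-- Chebyshev's inequality. -/
lemma three_quarters_le_measureReal {m : Measure ℝ} [IsProbabilityMeasure m]
    (hi : Integrable (fun x => x ^ 2) m) (h2 : ∫ x, x ^ 2 ∂m ≤ 1) :
    3 / 4 ≤ m.real (Set.Icc (-2) 2) := by
  have h := mul_meas_ge_le_integral_of_nonneg (μ := m) (.of_forall fun x => sq_nonneg x) hi 4
  have h3 : m.real (Set.Icc (-2) 2)ᶜ ≤ m.real {x : ℝ | 4 ≤ x ^ 2} := by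
    refine measureReal_mono fun x hx => ?_
    simp only [Set.mem_compl_iff, Set.mem_Icc, not_and_or, not_le] at hx
    simp only [Set.mem_ofPred_eq]
    rcases hx with hx | hx <;> nlinarith
  rw [measureReal_compl measurableSet_Icc, probReal_univ] at h3
  linarith

lemma IsDensity.setIntegral_le {m : Measure ℝ} {q : ℝ → ℝ} {M : ℝ}
    (hq : IsDensity m q) (hM : ∀ x, q x ≤ M) {f : ℝ → ℝ} (hf : Continuous f) (hf0 : ∀ x, 0 ≤ f x)
    {a b : ℝ} (hab : a ≤ b) :
    ∫ x in Set.Icc a b, f x ∂m ≤ M * ∫ x in a..b, f x := by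
  obtain ⟨h1, h2, h3⟩ := hq
  rw [h3, restrict_withDensity measurableSet_Icc,
    integral_withDensity_eq_integral_toReal_smul (by fun_prop) (by simp),
    intervalIntegral.integral_of_le hab, ← integral_Icc_eq_integral_Ioc, ← integral_const_mul]
  have hi : IntegrableOn f (Set.Icc a b) volume := hf.continuousOn.integrableOn_Icc
  refine integral_mono_of_nonneg (.of_forall fun x => ?_) (hi.const_mul M)
    (.of_forall fun x => ?_)
  · simp only [Pi.zero_apply, smul_eq_mul]; exact mul_nonneg (by simp) (hf0 x)
  · simp only [smul_eq_mul, ENNReal.toReal_ofReal (h2 x)]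
    exact mul_le_mul_of_nonneg_right (hM x) (hf0 x)

/-- A density of a law with second moment at most `1` cannot be small everywhere. -/
lemma IsDensity.three_sixteenths_le {m : Measure ℝ} [IsProbabilityMeasure m] {q : ℝ → ℝ} {M : ℝ}
    (hq : IsDensity m q) (hM : ∀ x, q x ≤ M)
    (hi : Integrable (fun x => x ^ 2) m) (h2 : ∫ x, x ^ 2 ∂m ≤ 1) : 3 / 16 ≤ M := by
  have h3 := three_quarters_le_measureReal hi h2
  have h4 := hq.setIntegral_le hM (f := fun _ => 1) continuous_const (by simp)
    (show (-2:ℝ) ≤ 2 by norm_num)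
  simp at h4
  linarith

lemma complexMGF_conj {Ω : Type*} [MeasurableSpace Ω] (X : Ω → ℝ) (P : Measure Ω) (z : ℂ) :
    complexMGF X P (starRingEnd ℂ z) = starRingEnd ℂ (complexMGF X P z) := by
  rw [complexMGF, complexMGF, ← integral_conj]
  simp [← exp_conj]

/-- The loss of modulus off the real axis, as an integral of squared sines with a common phase,
namely half the argument of the transform. -/
lemma mgf_sub_norm_complexMGF {m : Measure ℝ} {h : ℝ}
    (h1 : Integrable (fun x => Real.exp (h * x)) m) (t : ℝ) :
    ∃ θ : ℝ, mgf id m h - ‖complexMGF id m (h + t * I)‖ =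
      ∫ y, Real.exp (h * y) * (2 * Real.sin (t / 2 * y - θ) ^ 2) ∂m := by
  set z := complexMGF id m (h + t * I) with hz
  refine ⟨z.arg / 2, ?_⟩
  have hint : Integrable (fun y : ℝ => cexp ((h + t * I) * y) * cexp (-(z.arg * I))) m := by
    refine Integrable.mul_const (h1.mono' (by fun_prop) (.of_forall fun x => ?_)) _
    rw [norm_exp]; simp
  have hre : ∀ y : ℝ, (cexp ((h + t * I) * y) * cexp (-(z.arg * I))).re =
      Real.exp (h * y) * Real.cos (t * y - z.arg) := by
    intro y
    rw [← Complex.exp_add, exp_re]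
    congr 2 <;> simp
    ring
  have hnz : ‖z‖ = ∫ y, Real.exp (h * y) * Real.cos (t * y - z.arg) ∂m := by
    have e1 : (‖z‖ : ℂ) = z * cexp (-(z.arg * I)) := by
      rw [Complex.exp_neg, ← div_eq_mul_inv, eq_div_iff (Complex.exp_ne_zero _),
        norm_mul_exp_arg_mul_I]
    have e2 : ‖z‖ = (z * cexp (-(z.arg * I))).re := by rw [← e1, ofReal_re]
    have e3 : z = ∫ y : ℝ, cexp ((h + t * I) * y) ∂m := rfl
    rw [e2]
    nth_rewrite 1 [e3]
    rw [← integral_mul_const, ← reCLM_apply, ← reCLM.integral_comp_comm hint]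
    simp only [reCLM_apply, hre]
  have hint' : Integrable (fun y => Real.exp (h * y) * Real.cos (t * y - z.arg)) m := by
    exact hint.re.congr (.of_forall hre)
  have hmgf : mgf id m h = ∫ y, Real.exp (h * y) ∂m := rfl
  rw [hnz, hmgf, ← integral_sub h1 hint']
  congr with y
  have : t * y - z.arg = 2 * (t / 2 * y - z.arg / 2) := by ring
  rw [this, Real.cos_two_mul, Real.cos_sq']
  ring

/-- **Decay of the tilted characteristic function.** The modulus can be close to the value on
the real axis only if `t y / 2 - θ` concentrates near `π ℤ`, that is, where `cos ^ (2 k)` is close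
to `1`; a bounded density gives this set little mass once `k` is of order `M² / min(1, |t|)²`. -/
lemma norm_complexMGF_le_of_density {m : Measure ℝ} [IsProbabilityMeasure m] {q : ℝ → ℝ}
    {M h t : ℝ} (hq : IsDensity m q) (hM : ∀ x, q x ≤ M)
    (hi : Integrable (fun x => x ^ 2) m) (h2 : ∫ x, x ^ 2 ∂m ≤ 1)
    (hh : |h| ≤ 1 / 2) (h1 : Integrable (fun x => Real.exp (h * x)) m) :
    ‖complexMGF id m (h + t * I)‖ ≤ mgf id m h - min 1 |t| ^ 2 / (6000 * M ^ 2) := by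
  have hM0 := hq.three_sixteenths_le hM hi h2
  have hMp : 0 < M := by linarith
  wlog ht : 0 < t generalizing t with H
  · rcases (not_lt.mp ht).eq_or_lt with rfl | ht
    · simpa using norm_complexMGF_le_mgf (X := id) (μ := m) (z := (h : ℂ))
    · have := H (t := -t) (by linarith)
      rwa [abs_neg, show (h : ℂ) + ((-t : ℝ) : ℂ) * I = starRingEnd ℂ (h + t * I) by simp,
        complexMGF_conj, RCLike.norm_conj] at this
  rw [abs_of_pos ht]
  set s := min 1 t with hs
  have hs0 : 0 < s := lt_min one_pos ht
  have hs1 : s ≤ 1 := min_le_left _ _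
  have hst : s ≤ t := min_le_right _ _
  obtain ⟨θ, hθ⟩ := mgf_sub_norm_complexMGF h1 t
  set k : ℕ := ⌈1400 * M ^ 2 / s ^ 2⌉₊ with hk
  have hk1 : 1400 * M ^ 2 / s ^ 2 ≤ k := Nat.le_ceil _
  have hk0' : (0 : ℝ) < k := lt_of_lt_of_le (by positivity) hk1
  have hk0 : 0 < k := by exact_mod_cast hk0'
  have hk2 : (k : ℝ) ≤ 2000 * M ^ 2 / s ^ 2 := by
    have := (Nat.ceil_lt_add_one (show 0 ≤ 1400 * M ^ 2 / s ^ 2 by positivity)).le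
    have h3 : 1 ≤ 600 * M ^ 2 / s ^ 2 := by
      rw [le_div_iff₀ (by positivity)]; nlinarith
    have h4 : 2000 * M ^ 2 / s ^ 2 = 1400 * M ^ 2 / s ^ 2 + 600 * M ^ 2 / s ^ 2 := by ring
    linarith
  -- the periodic function `cos ^ (2 k)` carries at most a quarter of the mass
  have hcos : ∫ y in Set.Icc (-2) 2, Real.cos (t / 2 * y - θ) ^ (2 * k) ∂m ≤ 1 / 4 := by
    refine (hq.setIntegral_le hM (f := fun y => Real.cos (t / 2 * y - θ) ^ (2 * k)) (by fun_prop)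
      (fun x => (even_two_mul k).pow_nonneg _) (by norm_num)).trans ?_
    have h3 := integral_cos_affine_pow_le (half_pos ht) θ k hk0
    rw [show 2 * (t / 2) = t by ring] at h3
    refine (mul_le_mul_of_nonneg_left h3 hMp.le).trans ?_
    have h4 : 2 + Real.pi / t ≤ 5.15 / s := by
      have hpi := Real.pi_lt_d2
      have : 2 ≤ 2 / s := by rw [le_div_iff₀ hs0]; linarith
      have h5 : Real.pi / t ≤ 3.15 / s := by gcongr
      calc _ ≤ 2 / s + 3.15 / s := by linarith
        _ = _ := by ring
    have h5 : √(Real.pi / k) ≤ s / (20.6 * M) := by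
      refine Real.sqrt_le_iff.mpr ⟨by positivity, ?_⟩
      rw [div_le_iff₀ hk0']
      have hpi := Real.pi_lt_d2
      have : (s / (20.6 * M)) ^ 2 * (1400 * M ^ 2 / s ^ 2) ≤ (s / (20.6 * M)) ^ 2 * k := by gcongr
      have h6 : (s / (20.6 * M)) ^ 2 * (1400 * M ^ 2 / s ^ 2) = 1400 / 20.6 ^ 2 := by field_simp
      rw [h6] at this
      norm_num at this ⊢
      linarith
    calc M * ((2 + Real.pi / t) * √(Real.pi / k)) ≤ M * (5.15 / s * (s / (20.6 * M))) := by
          gcongr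
      _ = 1 / 4 := by field_simp; norm_num
  have hmass := three_quarters_le_measureReal hi h2
  have hint : Integrable (fun y => Real.exp (h * y) * (2 * Real.sin (t / 2 * y - θ) ^ 2)) m := by
    refine (h1.mul_const 2).mono' (by fun_prop) (.of_forall fun y => ?_)
    rw [Real.norm_of_nonneg (by positivity)]
    gcongr
    nlinarith [Real.sin_sq_le_one (t / 2 * y - θ)]
  have hint2 : IntegrableOn (fun y => Real.cos (t / 2 * y - θ) ^ (2 * k)) (Set.Icc (-2) 2) m :=
    Continuous.integrableOn_Icc (by fun_prop)
  have key : 1 / (3 * k : ℝ) ≤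
      ∫ y, Real.exp (h * y) * (2 * Real.sin (t / 2 * y - θ) ^ 2) ∂m := by
    calc 1 / (3 * k : ℝ) = 2 / (3 * k) * (3 / 4 - 1 / 4) := by field_simp; norm_num
      _ ≤ 2 / (3 * k) * (m.real (Set.Icc (-2) 2) -
            ∫ y in Set.Icc (-2) 2, Real.cos (t / 2 * y - θ) ^ (2 * k) ∂m) := by gcongr
      _ = ∫ y in Set.Icc (-2) 2, 2 / (3 * k) * (1 - Real.cos (t / 2 * y - θ) ^ (2 * k)) ∂m := by
          rw [integral_const_mul, integral_sub (integrable_const _) hint2]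
          simp
      _ ≤ ∫ y in Set.Icc (-2) 2, Real.exp (h * y) * (2 * Real.sin (t / 2 * y - θ) ^ 2) ∂m := by
          refine setIntegral_mono_on (((integrable_const _).sub hint2).const_mul _)
            hint.integrableOn measurableSet_Icc fun y hy => ?_
          have hexp : 1 / 3 ≤ Real.exp (h * y) := by
            have h3 : |h * y| ≤ 1 := by
              rw [abs_mul]
              have : |y| ≤ 2 := abs_le.mpr hy
              nlinarith [abs_nonneg h, abs_nonneg y]
            have h4 : Real.exp (-1) ≤ Real.exp (h * y) :=
              Real.exp_le_exp.mpr (abs_le.mp h3).1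
            have h5 : 1 / 3 ≤ Real.exp (-1) := by
              rw [Real.exp_neg, one_div]
              gcongr
              have := Real.exp_one_lt_d9
              linarith
            linarith
          have h6 := one_sub_cos_pow_le (t / 2 * y - θ) k
          calc _ ≤ 2 / (3 * k) * (k * Real.sin (t / 2 * y - θ) ^ 2) := by gcongr
            _ = 1 / 3 * (2 * Real.sin (t / 2 * y - θ) ^ 2) := by field_simp
            _ ≤ _ := by gcongr
      _ ≤ _ := setIntegral_le_integral hint (.of_forall fun y => by positivity)
  have hfin : s ^ 2 / (6000 * M ^ 2) ≤ 1 / (3 * k : ℝ) := by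
    rw [le_div_iff₀ (by positivity)] at hk2
    rw [div_le_div_iff₀ (by positivity) (by positivity)]
    linarith
  linarith

end

/-! ### The log-Laplace transform of a standardized random variable -/

section

variable {Ω : Type*} [MeasurableSpace Ω]

open Complex Metric

/-- A standardized random variable with the exponential moment condition `E e^{α|X|} ≤ 2`. -/
structure IsStandardized (X : Ω → ℝ) (P : Measure Ω) (α : ℝ) : Prop where
  aemeasurable : AEMeasurable X P
  integral_eq : ∫ ω, X ω ∂P = 0
  integral_sq : ∫ ω, X ω ^ 2 ∂P = 1
  pos : 0 < α
  integrable_exp : Integrable (fun ω => Real.exp (α * |X ω|)) P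
  integral_exp_le : ∫ ω, Real.exp (α * |X ω|) ∂P ≤ 2

lemma sq_mul_exp_le {u : ℝ} (hu : 0 ≤ u) : u ^ 2 * Real.exp (u / 8) ≤ 2 * (Real.exp u - 1) := by
  have h1 := Real.sum_le_exp_of_nonneg (show 0 ≤ 7 / 8 * u by positivity) 4
  simp [Finset.sum_range_succ, Nat.factorial] at h1
  have h2 : Real.exp u = Real.exp (u / 8) * Real.exp (7 / 8 * u) := by
    rw [← Real.exp_add]; ring_nf
  have h3 : 1 ≤ Real.exp (u / 8) := Real.one_le_exp (by positivity)
  have h4 : u ^ 2 ≤ 2 * (Real.exp (7 / 8 * u) - 1) := by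
    have : 0 ≤ u * (u - 1) ^ 2 := by positivity
    nlinarith
  nlinarith [mul_le_mul_of_nonneg_left h4 (Real.exp_pos (u / 8)).le]

lemma cube_mul_exp_le {u : ℝ} (hu : 0 ≤ u) : u ^ 3 * Real.exp (u / 8) ≤ 6 * (Real.exp u - 1) := by
  have h1 := Real.sum_le_exp_of_nonneg (show 0 ≤ 7 / 8 * u by positivity) 5
  simp [Finset.sum_range_succ, Nat.factorial] at h1
  have h2 : Real.exp u = Real.exp (u / 8) * Real.exp (7 / 8 * u) := by
    rw [← Real.exp_add]; ring_nf
  have h3 : 1 ≤ Real.exp (u / 8) := Real.one_le_exp (by positivity)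
  have h4 : u ^ 3 ≤ 6 * (Real.exp (7 / 8 * u) - 1) := by
    have h5 : 0 ≤ u * (5 * u - 6) ^ 2 := by positivity
    have h6 : 0 ≤ u ^ 2 * (u - 1) ^ 2 := by positivity
    nlinarith [pow_nonneg hu 2, pow_nonneg hu 3]
  nlinarith [mul_le_mul_of_nonneg_left h4 (Real.exp_pos (u / 8)).le]

lemma logLaplace_zero (X : Ω → ℝ) (P : Measure Ω) [IsProbabilityMeasure P] :
    logLaplace X P 0 = 0 := by
  simp [logLaplace, complexMGF]

namespace IsStandardized

variable {X : Ω → ℝ} {P : Measure Ω} {α : ℝ} (hX : IsStandardized X P α)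
include hX

lemma integrable_exp_mul {a : ℝ} (ha : |a| ≤ α) : Integrable (fun ω => Real.exp (a * X ω)) P := by
  have := hX.aemeasurable
  refine hX.integrable_exp.mono' (by fun_prop) (.of_forall fun ω => ?_)
  rw [Real.norm_of_nonneg (Real.exp_pos _).le]
  refine Real.exp_le_exp.mpr ((le_abs_self _).trans ?_)
  rw [abs_mul]; gcongr

-- A non-integrable square would have the junk integral `0`.
lemma integrable_sq : Integrable (fun ω => X ω ^ 2) P := by
  by_contra h
  have := integral_undef h
  rw [hX.integral_sq] at this
  exact one_ne_zero this

lemma re_mem_interior {z : ℂ} (hz : ‖z‖ < α) : z.re ∈ interior (integrableExpSet X P) := by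
  refine interior_maximal (s := integrableExpSet X P) (t := Set.Ioo (-α) α) (fun a ha => ?_)
    isOpen_Ioo (abs_lt.mp ((abs_re_le_norm z).trans_lt hz))
  exact hX.integrable_exp_mul (abs_le.mpr ⟨ha.1.le, ha.2.le⟩)

lemma integral_ofReal_eq : ∫ ω, (X ω : ℂ) ∂P = 0 := by
  rw [integral_complex_ofReal, hX.integral_eq, ofReal_zero]

lemma integral_ofReal_sq : ∫ ω, (X ω : ℂ) ^ 2 ∂P = 1 := by
  simp_rw [← ofReal_pow]
  rw [integral_complex_ofReal, hX.integral_sq, ofReal_one]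

lemma integrable_mul_exp {z : ℂ} (hz : ‖z‖ < α) (n : ℕ) :
    Integrable (fun ω => (X ω : ℂ) ^ n * cexp (z * X ω)) P :=
  integrable_pow_mul_cexp_of_re_mem_interior_integrableExpSet (hX.re_mem_interior hz) n

lemma hasDerivAt_complexMGF {z : ℂ} (hz : ‖z‖ < α) :
    HasDerivAt (complexMGF X P) (∫ ω, (X ω : ℂ) * cexp (z * X ω) ∂P) z :=
  ProbabilityTheory.hasDerivAt_complexMGF (hX.re_mem_interior hz)

lemma hasDerivAt_integral_mul_exp {z : ℂ} (hz : ‖z‖ < α) :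
    HasDerivAt (fun z => ∫ ω, (X ω : ℂ) * cexp (z * X ω) ∂P)
      (∫ ω, (X ω : ℂ) ^ 2 * cexp (z * X ω) ∂P) z := by
  simpa using hasDerivAt_integral_pow_mul_exp (hX.re_mem_interior hz) 1

variable [IsProbabilityMeasure P]

lemma integrable_exp_sub_one : Integrable (fun ω => Real.exp (α * |X ω|) - 1) P :=
  hX.integrable_exp.sub (integrable_const _)

lemma integral_exp_sub_one_le : ∫ ω, (Real.exp (α * |X ω|) - 1) ∂P ≤ 1 := by
  rw [integral_sub hX.integrable_exp (integrable_const _)]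
  have := hX.integral_exp_le
  simp
  linarith

/-- Expectations are controlled by the exponential moment. -/
lemma norm_integral_le {g : Ω → ℂ} {c : ℝ} (hc : 0 ≤ c)
    (hg : ∀ ω, ‖g ω‖ ≤ c * (Real.exp (α * |X ω|) - 1)) : ‖∫ ω, g ω ∂P‖ ≤ c := by
  refine (norm_integral_le_of_norm_le (hX.integrable_exp_sub_one.const_mul c)
    (.of_forall hg)).trans ?_
  rw [integral_const_mul]
  nlinarith [hX.integral_exp_sub_one_le]

lemma integrable_self : Integrable X P := by
  have h : MemLp X 2 P := (memLp_two_iff_integrable_sq hX.aemeasurable.aestronglyMeasurable).mpr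
    hX.integrable_sq
  exact h.integrable (by norm_num)

/-- The normalization of the variance bounds `α`, because `u² / 2 ≤ e^u - 1`. -/
lemma sq_le_two : α ^ 2 ≤ 2 := by
  have h1 : ∫ ω, α ^ 2 / 2 * X ω ^ 2 ∂P ≤ ∫ ω, (Real.exp (α * |X ω|) - 1) ∂P := by
    refine integral_mono (hX.integrable_sq.const_mul _) hX.integrable_exp_sub_one fun ω => ?_
    have h0 : 0 ≤ α * |X ω| := mul_nonneg hX.pos.le (abs_nonneg _)
    have := Real.quadratic_le_exp_of_nonneg h0
    rw [mul_pow, sq_abs] at this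
    simp only
    linarith
  rw [integral_const_mul, hX.integral_sq] at h1
  linarith [hX.integral_exp_sub_one_le]

lemma cube_le : α ^ 3 ≤ 2.83 := by
  have h1 := hX.sq_le_two
  have h2 := hX.pos
  have h3 : α ≤ 1.415 := by nlinarith
  calc α ^ 3 = α ^ 2 * α := by ring
    _ ≤ 2 * 1.415 := by gcongr
    _ = 2.83 := by norm_num

lemma cube_div_le : α ^ 3 / 16 ≤ α / 8 := by
  nlinarith [hX.sq_le_two, hX.pos]

lemma norm_complexMGF_sub_one_le_half {z : ℂ} (hz : ‖z‖ ≤ α / 2) :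
    ‖complexMGF X P z - 1‖ ≤ 1 / 2 := by
  have hm := hX.aemeasurable
  have hα := hX.pos
  have hi : Integrable (fun ω => cexp (z * X ω)) P := by
    refine (hX.integrable_exp_mul (a := z.re) ((abs_re_le_norm z).trans (by linarith))).mono'
      (by fun_prop) (.of_forall fun ω => ?_)
    rw [norm_exp]; simp
  have h1 : complexMGF X P z - 1 = ∫ ω, (cexp (z * X ω) - 1) ∂P := by
    rw [integral_sub hi (integrable_const _)]; simp [complexMGF]
  rw [h1]
  refine hX.norm_integral_le (by norm_num) fun ω => ?_
  have h2 := norm_exp_sub_sum_le_exp_norm_sub_sum (z * X ω) 1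
  simp only [Finset.range_one, Finset.sum_singleton, pow_zero, Nat.factorial_zero, Nat.cast_one,
    div_one] at h2
  have h3 : ‖z * X ω‖ ≤ α * |X ω| / 2 := by
    rw [norm_mul, norm_real, Real.norm_eq_abs]
    nlinarith [abs_nonneg (X ω)]
  have h4 := Real.exp_le_exp.mpr h3
  have h5 : Real.exp (α * |X ω|) = Real.exp (α * |X ω| / 2) ^ 2 := by
    rw [← Real.exp_nat_mul]; congr 1; push_cast; ring
  nlinarith [sq_nonneg (Real.exp (α * |X ω| / 2) - 1)]

lemma norm_complexMGF_sub_one_le {z : ℂ} (hz : ‖z‖ ≤ α / 8) :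
    ‖complexMGF X P z - 1‖ ≤ 2 * ‖z‖ ^ 2 / α ^ 2 := by
  have hα := hX.pos
  have hi := hX.integrable_mul_exp (z := z) (by linarith) 0
  simp only [pow_zero, one_mul] at hi
  have hzi : Integrable (fun ω => z * (X ω : ℂ)) P := hX.integrable_self.ofReal.const_mul z
  have h1 : complexMGF X P z - 1 = ∫ ω, (cexp (z * X ω) - (1 + z * X ω)) ∂P := by
    rw [integral_sub hi (by fun_prop), integral_add (integrable_const _) hzi,
      integral_const_mul, hX.integral_ofReal_eq]
    simp [complexMGF]
  rw [h1]
  refine hX.norm_integral_le (by positivity) fun ω => ?_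
  have h2 := norm_exp_sub_sum_le_norm_mul_exp (z * X ω) 2
  simp only [Finset.sum_range_succ, Finset.range_zero, Finset.sum_empty, pow_zero,
    Nat.factorial_zero, Nat.cast_one, div_one, zero_add, pow_one, Nat.factorial_one] at h2
  refine h2.trans ?_
  set u := α * |X ω| with hu
  have hu0 : 0 ≤ u := by positivity
  have hzX : ‖z * X ω‖ = ‖z‖ / α * u := by
    rw [norm_mul, norm_real, Real.norm_eq_abs, hu]; field_simp
  have h3 : ‖z‖ / α ≤ 1 / 8 := by rw [div_le_iff₀ hα]; linarith
  rw [hzX]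
  calc (‖z‖ / α * u) ^ 2 * Real.exp (‖z‖ / α * u)
      ≤ (‖z‖ / α * u) ^ 2 * Real.exp (u / 8) := by gcongr; nlinarith
    _ = (‖z‖ / α) ^ 2 * (u ^ 2 * Real.exp (u / 8)) := by ring
    _ ≤ (‖z‖ / α) ^ 2 * (2 * (Real.exp u - 1)) :=
        mul_le_mul_of_nonneg_left (sq_mul_exp_le hu0) (by positivity)
    _ = _ := by ring

lemma norm_integral_sq_mul_exp_sub_one_le {z : ℂ} (hz : ‖z‖ ≤ α / 8) :
    ‖∫ ω, (X ω : ℂ) ^ 2 * cexp (z * X ω) ∂P - 1‖ ≤ 6 * ‖z‖ / α ^ 3 := by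
  have hα := hX.pos
  have hi := hX.integrable_mul_exp (z := z) (by linarith) 2
  have h1 : ∫ ω, (X ω : ℂ) ^ 2 * cexp (z * X ω) ∂P - 1 =
      ∫ ω, ((X ω : ℂ) ^ 2 * cexp (z * X ω) - ((X ω ^ 2 : ℝ) : ℂ)) ∂P := by
    have hsq : Integrable (fun ω => ((X ω ^ 2 : ℝ) : ℂ)) P := hX.integrable_sq.ofReal
    rw [integral_sub hi hsq, integral_complex_ofReal, hX.integral_sq, ofReal_one]
  rw [h1]
  refine hX.norm_integral_le (by positivity) fun ω => ?_
  have h2 := norm_exp_sub_sum_le_norm_mul_exp (z * X ω) 1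
  simp only [Finset.range_one, Finset.sum_singleton, pow_zero, Nat.factorial_zero, Nat.cast_one,
    div_one, pow_one] at h2
  set u := α * |X ω| with hu
  have hu0 : 0 ≤ u := by positivity
  have hzX : ‖z * X ω‖ = ‖z‖ / α * u := by
    rw [norm_mul, norm_real, Real.norm_eq_abs, hu]; field_simp
  have h3 : ‖z‖ / α ≤ 1 / 8 := by rw [div_le_iff₀ hα]; linarith
  rw [show (X ω : ℂ) ^ 2 * cexp (z * X ω) - ((X ω ^ 2 : ℝ) : ℂ) =
    (X ω : ℂ) ^ 2 * (cexp (z * X ω) - 1) by push_cast; ring, norm_mul, norm_pow, norm_real,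
    Real.norm_eq_abs]
  have hXu : |X ω| = u / α := by rw [hu]; field_simp
  rw [hzX] at h2
  calc |X ω| ^ 2 * ‖cexp (z * X ω) - 1‖
      ≤ |X ω| ^ 2 * (‖z‖ / α * u * Real.exp (‖z‖ / α * u)) := by gcongr
    _ ≤ |X ω| ^ 2 * (‖z‖ / α * u * Real.exp (u / 8)) := by gcongr; nlinarith
    _ = ‖z‖ / α ^ 3 * (u ^ 3 * Real.exp (u / 8)) := by rw [hXu]; field_simp
    _ ≤ ‖z‖ / α ^ 3 * (6 * (Real.exp u - 1)) :=
        mul_le_mul_of_nonneg_left (cube_mul_exp_le hu0) (by positivity)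
    _ = _ := by ring

lemma norm_integral_mul_exp_le {z : ℂ} (hz : ‖z‖ ≤ α ^ 3 / 16) :
    ‖∫ ω, (X ω : ℂ) * cexp (z * X ω) ∂P‖ ≤ 11 / 8 * ‖z‖ := by
  have hα := hX.pos
  have h8 := hX.cube_div_le
  have hz0 : (0 : ℂ) ∈ closedBall (0 : ℂ) (α ^ 3 / 16) := by simp; positivity
  have := (convex_closedBall (0 : ℂ) (α ^ 3 / 16)).norm_image_sub_le_of_norm_hasDerivWithin_le
    (f := fun z => ∫ ω, (X ω : ℂ) * cexp (z * X ω) ∂P)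
    (f' := fun z => ∫ ω, (X ω : ℂ) ^ 2 * cexp (z * X ω) ∂P) (C := 11 / 8)
    (fun w hw => (hX.hasDerivAt_integral_mul_exp
      (by rw [mem_closedBall_zero_iff] at hw; linarith)).hasDerivWithinAt) (fun w hw => ?_) hz0
      (mem_closedBall_zero_iff.mpr hz)
  · simpa [hX.integral_ofReal_eq] using this
  · rw [mem_closedBall_zero_iff] at hw
    have h1 := hX.norm_integral_sq_mul_exp_sub_one_le (hw.trans h8)
    have h2 : 6 * ‖w‖ / α ^ 3 ≤ 3 / 8 := by
      rw [div_le_iff₀ (by positivity)]; linarith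
    have h3 := norm_sub_norm_le (∫ ω, (X ω : ℂ) ^ 2 * cexp (w * X ω) ∂P) 1
    rw [norm_one] at h3
    linarith

lemma complexMGF_mem_slitPlane {z : ℂ} (hz : ‖z‖ ≤ α / 2) : complexMGF X P z ∈ slitPlane := by
  have h1 := hX.norm_complexMGF_sub_one_le_half hz
  left
  have h2 := abs_le.mp (abs_re_le_norm (complexMGF X P z - 1))
  simp only [sub_re, one_re] at h2
  linarith [h2.1]

lemma complexMGF_ne_zero {z : ℂ} (hz : ‖z‖ ≤ α / 2) : complexMGF X P z ≠ 0 :=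
  slitPlane_ne_zero (hX.complexMGF_mem_slitPlane hz)

lemma exp_logLaplace {z : ℂ} (hz : ‖z‖ ≤ α / 2) : cexp (logLaplace X P z) = complexMGF X P z :=
  exp_log (hX.complexMGF_ne_zero hz)

lemma norm_logLaplace_le {z : ℂ} (hz : ‖z‖ ≤ α / 2) : ‖logLaplace X P z‖ ≤ 1 := by
  have h1 := hX.norm_complexMGF_sub_one_le_half hz
  have h2 := norm_log_one_add_half_le_self h1
  rw [add_sub_cancel] at h2
  exact h2.trans (by linarith)

lemma hasDerivAt_logLaplace {z : ℂ} (hz : ‖z‖ ≤ α / 2) :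
    HasDerivAt (logLaplace X P) ((∫ ω, (X ω : ℂ) * cexp (z * X ω) ∂P) / complexMGF X P z) z :=
  (hX.hasDerivAt_complexMGF (by linarith [hX.pos])).clog (hX.complexMGF_mem_slitPlane hz)

lemma differentiableOn_logLaplace : DifferentiableOn ℂ (logLaplace X P) (ball 0 (α / 2)) :=
  fun _ hz => (hX.hasDerivAt_logLaplace
    (mem_ball_zero_iff.mp hz).le).differentiableAt.differentiableWithinAt

lemma hasDerivAt_deriv_logLaplace {z : ℂ} (hz : ‖z‖ < α / 2) :
    HasDerivAt (deriv (logLaplace X P))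
      (((∫ ω, (X ω : ℂ) ^ 2 * cexp (z * X ω) ∂P) * complexMGF X P z -
        (∫ ω, (X ω : ℂ) * cexp (z * X ω) ∂P) ^ 2) / complexMGF X P z ^ 2) z := by
  have hα : ‖z‖ < α := by linarith [hX.pos]
  have h1 := (hX.hasDerivAt_integral_mul_exp hα).div (hX.hasDerivAt_complexMGF hα)
    (hX.complexMGF_ne_zero hz.le)
  rw [← pow_two] at h1
  refine h1.congr_of_eventuallyEq ?_
  filter_upwards [isOpen_ball.mem_nhds (mem_ball_zero_iff.mpr hz)] with w hw
  exact (hX.hasDerivAt_logLaplace (mem_ball_zero_iff.mp hw).le).deriv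

/-- The second derivative of the log-Laplace transform is close to the variance near `0`. -/
lemma norm_deriv_deriv_logLaplace_sub_one_le {z : ℂ} (hz : ‖z‖ ≤ α ^ 3 / 16) :
    ‖deriv (deriv (logLaplace X P)) z - 1‖ ≤ 1 / 2 := by
  have hα := hX.pos
  have h8 := hX.cube_div_le
  have hz8 := hz.trans h8
  rw [(hX.hasDerivAt_deriv_logLaplace (by linarith)).deriv]
  have hf0 := hX.complexMGF_ne_zero (z := z) (by linarith)
  have a1 := hX.norm_complexMGF_sub_one_le hz8
  have a2 := hX.norm_integral_sq_mul_exp_sub_one_le hz8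
  have a3 := hX.norm_integral_mul_exp_le hz
  have b1 : 2 * ‖z‖ ^ 2 / α ^ 2 ≤ 1 / 32 := by
    rw [div_le_iff₀ (by positivity)]; nlinarith [norm_nonneg z]
  have b2 : 6 * ‖z‖ / α ^ 3 ≤ 3 / 8 := by rw [div_le_iff₀ (by positivity)]; linarith
  have b3 : 11 / 8 * ‖z‖ ≤ 0.2433 := by
    have := hX.cube_le
    norm_num at this ⊢
    linarith
  set f := complexMGF X P z
  set f1 := ∫ ω, (X ω : ℂ) * cexp (z * X ω) ∂P
  set f2 := ∫ ω, (X ω : ℂ) ^ 2 * cexp (z * X ω) ∂P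
  have c1 : 31 / 32 ≤ ‖f‖ := by
    have := norm_sub_norm_le 1 f
    rw [norm_one, norm_sub_rev] at this
    linarith
  have e : (f2 * f - f1 ^ 2) / f ^ 2 - 1 = ((f2 - 1) - (f - 1)) / f - (f1 / f) ^ 2 := by
    field_simp; ring
  rw [e]
  have d1 : ‖((f2 - 1) - (f - 1)) / f‖ ≤ (13 / 32) / (31 / 32) := by
    rw [norm_div]
    gcongr
    refine (norm_sub_le _ _).trans ?_
    linarith
  have d2 : ‖(f1 / f) ^ 2‖ ≤ (0.2433 / (31 / 32)) ^ 2 := by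
    rw [norm_pow, norm_div]
    gcongr
    linarith
  refine (norm_sub_le _ _).trans ((add_le_add d1 d2).trans ?_)
  norm_num

lemma deriv_logLaplace_zero : deriv (logLaplace X P) 0 = 0 := by
  rw [(hX.hasDerivAt_logLaplace (z := 0) (by simp; linarith [hX.pos])).deriv]
  simp [hX.integral_ofReal_eq]

lemma deriv_deriv_logLaplace_zero : deriv (deriv (logLaplace X P)) 0 = 1 := by
  rw [(hX.hasDerivAt_deriv_logLaplace (z := 0) (by simp; linarith [hX.pos])).deriv]
  simp [hX.integral_ofReal_eq, hX.integral_ofReal_sq, complexMGF]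

lemma logLaplace_conj {z : ℂ} (hz : ‖z‖ ≤ α / 2) :
    logLaplace X P (starRingEnd ℂ z) = starRingEnd ℂ (logLaplace X P z) := by
  rw [logLaplace, complexMGF_conj, logLaplace,
    log_conj _ (slitPlane_arg_ne_pi (hX.complexMGF_mem_slitPlane hz))]

end IsStandardized

end

/-! ### Saddle points and Cramér's function -/

section

variable {Ω : Type*} [MeasurableSpace Ω]

open Complex Metric Topology

/-- Dividing out a zero of order `n` at the centre of a disc, with the Taylor coefficient as the
value at the centre, leaves a holomorphic function. -/
lemma differentiableOn_div_pow_of_iteratedDeriv_eq_zero {f : ℂ → ℂ} {r : ℝ} (hr : 0 < r)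
    (hf : DifferentiableOn ℂ f (ball 0 r)) (n : ℕ) (h0 : ∀ k < n, iteratedDeriv k f 0 = 0)
    {g : ℂ → ℂ} (hg0 : g 0 = iteratedDeriv n f 0 / n.factorial)
    (hg : ∀ τ ≠ 0, g τ = f τ / τ ^ n) : DifferentiableOn ℂ g (ball 0 r) := by
  have hn : ball (0 : ℂ) r ∈ 𝓝 0 := ball_mem_nhds _ hr
  have hp := (hf.analyticAt hn).hasFPowerSeriesAt
  have hval : ∀ k, (Function.swap dslope 0)^[k] f 0 = iteratedDeriv k f 0 / k.factorial := by
    intro k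
    rw [← (hp.has_fpower_series_iterate_dslope_fslope k).coeff_zero 1,
      ← FormalMultilinearSeries.coeff, FormalMultilinearSeries.coeff_iterate_fslope, zero_add,
      FormalMultilinearSeries.coeff_ofScalars]
  have hdiff : ∀ k, DifferentiableOn ℂ ((Function.swap dslope 0)^[k] f) (ball 0 r) := by
    intro k
    induction k with
    | zero => exact hf
    | succ k ih =>
      rw [Function.iterate_succ_apply']
      exact (differentiableOn_dslope hn).mpr ih
  have heq : g = (Function.swap dslope 0)^[n] f := by
    funext τ
    rcases eq_or_ne τ 0 with rfl | hτ
    · rw [hg0, hval]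
    · have := pow_sub_smul_iterate_dslope_of_zero (f := f) (a := (0 : ℂ)) (n := n)
        (fun k hk => by rw [hval, h0 k hk, zero_div]) τ
      rw [sub_zero, smul_eq_mul] at this
      rw [hg τ hτ, ← this]
      field_simp
  rw [heq]
  exact hdiff n

lemma muFun_eq (X : Ω → ℝ) (P : Measure Ω) (α : ℝ) (τ : ℂ) :
    muFun X P α τ = Complex.log (deriv (deriv (logLaplace X P)) (saddlePoint X P α τ)) / 2 := by
  rw [muFun, iteratedDeriv_succ, iteratedDeriv_one]

namespace IsStandardized

variable {X : Ω → ℝ} {P : Measure Ω} [IsProbabilityMeasure P] {α : ℝ} (hX : IsStandardized X P α)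
include hX

lemma hasDerivAt_deriv_logLaplace' {z : ℂ} (hz : ‖z‖ ≤ α ^ 3 / 16) :
    HasDerivAt (deriv (logLaplace X P)) (deriv (deriv (logLaplace X P)) z) z := by
  have h := hX.cube_div_le
  have := hX.pos
  exact (hX.hasDerivAt_deriv_logLaplace (z := z) (by linarith)).differentiableAt.hasDerivAt

lemma norm_sub_deriv_logLaplace_le {z w : ℂ} (hz : ‖z‖ ≤ α ^ 3 / 16) (hw : ‖w‖ ≤ α ^ 3 / 16) :
    ‖(w - deriv (logLaplace X P) w) - (z - deriv (logLaplace X P) z)‖ ≤ 1 / 2 * ‖w - z‖ := by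
  refine (convex_closedBall (0 : ℂ) (α ^ 3 / 16)).norm_image_sub_le_of_norm_hasDerivWithin_le
    (f := fun z => z - deriv (logLaplace X P) z)
    (f' := fun z => 1 - deriv (deriv (logLaplace X P)) z)
    (fun u hu => ?_) (fun u hu => ?_) (mem_closedBall_zero_iff.mpr hz)
    (mem_closedBall_zero_iff.mpr hw)
  · exact ((hasDerivAt_id u).sub (hX.hasDerivAt_deriv_logLaplace'
      (mem_closedBall_zero_iff.mp hu))).hasDerivWithinAt
  · rw [norm_sub_rev]
    exact hX.norm_deriv_deriv_logLaplace_sub_one_le (mem_closedBall_zero_iff.mp hu)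

/-- `K'` expands distances by at least `1/2`. -/
lemma norm_sub_le_two_mul {z w : ℂ} (hz : ‖z‖ ≤ α ^ 3 / 16) (hw : ‖w‖ ≤ α ^ 3 / 16) :
    ‖w - z‖ ≤ 2 * ‖deriv (logLaplace X P) w - deriv (logLaplace X P) z‖ := by
  have h := hX.norm_sub_deriv_logLaplace_le hz hw
  rw [sub_sub_sub_comm] at h
  have := norm_sub_norm_le (w - z) (deriv (logLaplace X P) w - deriv (logLaplace X P) z)
  linarith

/-- Existence of the saddle point, by the contraction principle. -/
lemma exists_isSaddlePoint {τ : ℂ} (hτ : ‖τ‖ ≤ α ^ 3 / 32) : ∃ z, IsSaddlePoint X P α τ z := by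
  have hα := hX.pos
  set F : ℂ → ℂ := fun z => z - deriv (logLaplace X P) z + τ with hF
  have h0 : (0 : ℂ) ∈ closedBall (0 : ℂ) (α ^ 3 / 16) := by simp; positivity
  have hmaps : Set.MapsTo F (closedBall 0 (α ^ 3 / 16)) (closedBall 0 (α ^ 3 / 16)) := by
    intro z hz
    rw [mem_closedBall_zero_iff] at hz ⊢
    have h1 := hX.norm_sub_deriv_logLaplace_le (z := 0) (w := z) (by simpa using h0) hz
    rw [hX.deriv_logLaplace_zero, sub_zero, sub_zero, sub_zero] at h1
    calc ‖F z‖ ≤ ‖z - deriv (logLaplace X P) z‖ + ‖τ‖ := norm_add_le _ _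
      _ ≤ _ := by linarith
  have hcontr : ContractingWith (1 / 2) (hmaps.restrict F _ _) := by
    refine ⟨by norm_num, LipschitzWith.of_dist_le_mul fun z w => ?_⟩
    rw [Subtype.dist_eq, Subtype.dist_eq, dist_eq_norm, dist_eq_norm]
    have h1 := hX.norm_sub_deriv_logLaplace_le (mem_closedBall_zero_iff.mp w.2)
      (mem_closedBall_zero_iff.mp z.2)
    simpa [hF] using h1
  obtain ⟨z, hz, hfix, -⟩ := hcontr.exists_fixedPoint' isClosed_closedBall.isComplete hmaps h0
    (edist_ne_top _ _)
  refine ⟨z, mem_closedBall_zero_iff.mp hz, ?_⟩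
  have : F z = z := hfix
  rw [hF] at this
  linear_combination -this

lemma isSaddlePoint_unique {τ z w : ℂ} (hz : IsSaddlePoint X P α τ z)
    (hw : IsSaddlePoint X P α τ w) : z = w := by
  have := hX.norm_sub_le_two_mul hw.1 hz.1
  rw [hz.2, hw.2, sub_self, norm_zero, mul_zero] at this
  exact sub_eq_zero.mp (norm_le_zero_iff.mp this)

lemma existsUnique_isSaddlePoint {τ : ℂ} (hτ : ‖τ‖ ≤ α ^ 3 / 32) :
    ∃! z, IsSaddlePoint X P α τ z :=
  existsUnique_of_exists_of_unique (hX.exists_isSaddlePoint hτ)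
    fun _ _ => hX.isSaddlePoint_unique

lemma isSaddlePoint_saddlePoint {τ : ℂ} (hτ : ‖τ‖ ≤ α ^ 3 / 32) :
    IsSaddlePoint X P α τ (saddlePoint X P α τ) :=
  Classical.epsilon_spec (hX.exists_isSaddlePoint hτ)

lemma norm_saddlePoint_sub_le {τ τ' : ℂ} (hτ : ‖τ‖ ≤ α ^ 3 / 32) (hτ' : ‖τ'‖ ≤ α ^ 3 / 32) :
    ‖saddlePoint X P α τ - saddlePoint X P α τ'‖ ≤ 2 * ‖τ - τ'‖ := by
  have h1 := hX.isSaddlePoint_saddlePoint hτ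
  have h2 := hX.isSaddlePoint_saddlePoint hτ'
  have := hX.norm_sub_le_two_mul h2.1 h1.1
  rwa [h1.2, h2.2] at this

lemma saddlePoint_zero : saddlePoint X P α 0 = 0 := by
  have hα := hX.pos
  refine hX.isSaddlePoint_unique (τ := 0) (hX.isSaddlePoint_saddlePoint (by simp; positivity))
    ⟨by simp; positivity, hX.deriv_logLaplace_zero⟩

lemma norm_saddlePoint_le {τ : ℂ} (hτ : ‖τ‖ ≤ α ^ 3 / 32) : ‖saddlePoint X P α τ‖ ≤ 2 * ‖τ‖ := by
  have hα := hX.pos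
  simpa [hX.saddlePoint_zero] using hX.norm_saddlePoint_sub_le hτ (τ' := 0) (by simp; positivity)

lemma deriv_deriv_logLaplace_mem_slitPlane {z : ℂ} (hz : ‖z‖ ≤ α ^ 3 / 16) :
    deriv (deriv (logLaplace X P)) z ∈ slitPlane := by
  have h1 := hX.norm_deriv_deriv_logLaplace_sub_one_le hz
  left
  have h2 := (abs_le.mp ((abs_re_le_norm _).trans h1)).1
  simp only [sub_re, one_re] at h2
  linarith

/-- The saddle point depends holomorphically on `τ`. -/
lemma hasDerivAt_saddlePoint {τ : ℂ} (hτ : ‖τ‖ < α ^ 3 / 32) :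
    HasDerivAt (saddlePoint X P α)
      (deriv (deriv (logLaplace X P)) (saddlePoint X P α τ))⁻¹ τ := by
  have hs := hX.isSaddlePoint_saddlePoint hτ.le
  have hnhds : ∀ᶠ σ in 𝓝 τ, ‖σ‖ ≤ α ^ 3 / 32 :=
    (continuous_norm.tendsto τ).eventually (eventually_le_nhds hτ)
  refine HasDerivAt.of_local_left_inverse ?_ (hX.hasDerivAt_deriv_logLaplace' hs.1)
    (slitPlane_ne_zero (hX.deriv_deriv_logLaplace_mem_slitPlane hs.1)) ?_
  · rw [ContinuousAt, tendsto_iff_norm_sub_tendsto_zero]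
    have h2 : Filter.Tendsto (fun σ : ℂ => 2 * ‖σ - τ‖) (𝓝 τ) (𝓝 0) := by
      have : Continuous (fun σ : ℂ => 2 * ‖σ - τ‖) := by fun_prop
      simpa using this.tendsto τ
    refine squeeze_zero' (.of_forall fun _ => norm_nonneg _) ?_ h2
    filter_upwards [hnhds] with σ hσ using hX.norm_saddlePoint_sub_le hσ hτ.le
  · filter_upwards [hnhds] with σ hσ using (hX.isSaddlePoint_saddlePoint hσ).2

/-- The derivative of `ψ` is `τ - z₀(τ)`, as `z₀(τ)` is a critical point of `K(z) - τ z`. -/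
lemma hasDerivAt_saddleValue {τ : ℂ} (hτ : ‖τ‖ < α ^ 3 / 32) :
    HasDerivAt (saddleValue X P α) (τ - saddlePoint X P α τ) τ := by
  have hs := hX.isSaddlePoint_saddlePoint hτ.le
  have hα := hX.pos
  have h8 := hX.cube_div_le
  have hz := hX.hasDerivAt_saddlePoint hτ
  have hK := (hX.hasDerivAt_logLaplace (z := saddlePoint X P α τ)
    (by linarith [hs.1])).differentiableAt.hasDerivAt
  rw [hs.2] at hK
  have h := ((hK.comp τ hz).sub ((hasDerivAt_id τ).mul hz)).add
    ((hasDerivAt_pow 2 τ).div_const 2)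
  refine HasDerivAt.congr_deriv (h.congr_of_eventuallyEq (.of_forall fun σ => ?_)) ?_
  · simp [saddleValue]
  · simp; ring

lemma differentiableOn_saddleValue :
    DifferentiableOn ℂ (saddleValue X P α) (ball 0 (α ^ 3 / 32)) :=
  fun _ h => (hX.hasDerivAt_saddleValue
    (mem_ball_zero_iff.mp h)).differentiableAt.differentiableWithinAt

lemma saddleValue_zero : saddleValue X P α 0 = 0 := by
  simp [saddleValue, hX.saddlePoint_zero, logLaplace_zero]

lemma iteratedDeriv_saddleValue_zero (k : ℕ) (hk : k < 3) :
    iteratedDeriv k (saddleValue X P α) 0 = 0 := by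
  have hα := hX.pos
  have hr : ‖(0 : ℂ)‖ < α ^ 3 / 32 := by simp; positivity
  have hev : deriv (saddleValue X P α) =ᶠ[𝓝 0] fun τ => τ - saddlePoint X P α τ := by
    filter_upwards [isOpen_ball.mem_nhds (mem_ball_zero_iff.mpr hr)] with τ hτ
    exact (hX.hasDerivAt_saddleValue (mem_ball_zero_iff.mp hτ)).deriv
  interval_cases k
  · simp [hX.saddleValue_zero]
  · simp [hev.eq_of_nhds, hX.saddlePoint_zero]
  · rw [iteratedDeriv_succ, iteratedDeriv_one, hev.deriv_eq]
    have := (hasDerivAt_id (0 : ℂ)).sub (hX.hasDerivAt_saddlePoint hr)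
    rw [hX.saddlePoint_zero, hX.deriv_deriv_logLaplace_zero, inv_one, sub_self] at this
    exact this.deriv

lemma differentiableOn_cramer : DifferentiableOn ℂ (cramer X P α) (ball 0 (α ^ 3 / 32)) := by
  have hα := hX.pos
  refine differentiableOn_div_pow_of_iteratedDeriv_eq_zero (by positivity)
    hX.differentiableOn_saddleValue 3 hX.iteratedDeriv_saddleValue_zero ?_ fun τ hτ => ?_
  · simp [cramer, Nat.factorial]
  · simp [cramer, hτ]

lemma pow_mul_cramer (τ : ℂ) : τ ^ 3 * cramer X P α τ = saddleValue X P α τ := by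
  rcases eq_or_ne τ 0 with rfl | h
  · simp [hX.saddleValue_zero]
  · simp only [cramer, h, if_false]; field_simp

lemma differentiableOn_muFun : DifferentiableOn ℂ (muFun X P α) (ball 0 (α ^ 3 / 32)) := by
  intro τ hτ
  rw [mem_ball_zero_iff] at hτ
  have hα := hX.pos
  have h8 := hX.cube_div_le
  have hs := hX.isSaddlePoint_saddlePoint hτ.le
  have hK : DifferentiableAt ℂ (deriv (deriv (logLaplace X P))) (saddlePoint X P α τ) :=
    ((hX.differentiableOn_logLaplace.deriv isOpen_ball).deriv isOpen_ball).differentiableAt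
      (isOpen_ball.mem_nhds (mem_ball_zero_iff.mpr (by linarith [hs.1])))
  have h := ((hK.comp τ (hX.hasDerivAt_saddlePoint hτ).differentiableAt).clog
    (hX.deriv_deriv_logLaplace_mem_slitPlane hs.1)).div_const 2
  refine DifferentiableAt.differentiableWithinAt (h.congr_of_eventuallyEq (.of_forall fun σ => ?_))
  exact muFun_eq X P α σ

lemma muFun_zero : muFun X P α 0 = 0 := by
  simp [muFun_eq, hX.saddlePoint_zero, hX.deriv_deriv_logLaplace_zero]

lemma isSaddlePoint_conj {τ z : ℂ} (h : IsSaddlePoint X P α τ z) :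
    IsSaddlePoint X P α (starRingEnd ℂ τ) (starRingEnd ℂ z) := by
  have hα := hX.pos
  have h8 := hX.cube_div_le
  refine ⟨by rw [RCLike.norm_conj]; exact h.1, ?_⟩
  have hz : ‖z‖ < α / 2 := by linarith [h.1]
  have hev : logLaplace X P =ᶠ[𝓝 (starRingEnd ℂ z)]
      (starRingEnd ℂ ∘ logLaplace X P ∘ starRingEnd ℂ) := by
    filter_upwards [isOpen_ball.mem_nhds (mem_ball_zero_iff.mpr
      (show ‖starRingEnd ℂ z‖ < α / 2 by rwa [RCLike.norm_conj]))] with w hw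
    simp [hX.logLaplace_conj (mem_ball_zero_iff.mp hw).le]
  rw [hev.deriv_eq, deriv_conj_conj]
  simp [h.2]

/-- For real `τ` the saddle point is real. -/
lemma exists_real_saddlePoint {τ : ℝ} (hτ : |τ| ≤ α ^ 3 / 32) :
    ∃ h : ℝ, saddlePoint X P α τ = h ∧ |h| ≤ 2 * |τ| := by
  have hτ' : ‖(τ : ℂ)‖ ≤ α ^ 3 / 32 := by rwa [norm_real]
  have h1 := hX.isSaddlePoint_saddlePoint hτ'
  have h2 := hX.isSaddlePoint_conj h1
  rw [conj_ofReal] at h2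
  obtain ⟨h, hh⟩ := conj_eq_iff_real.mp (hX.isSaddlePoint_unique h2 h1)
  refine ⟨h, hh, ?_⟩
  have := hX.norm_saddlePoint_le hτ'
  rwa [hh, norm_real, norm_real] at this

/-- For real arguments `K''` is real and close to `1`. -/
lemma exists_real_deriv_deriv_logLaplace {h : ℝ} (hh : |h| ≤ α ^ 3 / 16) :
    ∃ v : ℝ, deriv (deriv (logLaplace X P)) h = v ∧ 1 / 2 ≤ v ∧ v ≤ 3 / 2 := by
  have hα := hX.pos
  have h8 := hX.cube_div_le
  have hev : logLaplace X P =ᶠ[𝓝 (h : ℂ)]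
      (starRingEnd ℂ ∘ logLaplace X P ∘ starRingEnd ℂ) := by
    filter_upwards [isOpen_ball.mem_nhds (mem_ball_zero_iff.mpr
      (show ‖(h : ℂ)‖ < α / 2 by rw [norm_real, Real.norm_eq_abs]; linarith))] with w hw
    simp [hX.logLaplace_conj (mem_ball_zero_iff.mp hw).le]
  have h1 : deriv (deriv (logLaplace X P)) h =
      starRingEnd ℂ (deriv (deriv (logLaplace X P)) h) := by
    conv_lhs => rw [hev.deriv.deriv_eq, deriv_conj_conj, deriv_conj_conj]
    simp
  obtain ⟨v, hv⟩ := conj_eq_iff_real.mp h1.symm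
  have h2 := hX.norm_deriv_deriv_logLaplace_sub_one_le (z := h)
    (by rwa [norm_real])
  rw [hv, ← ofReal_one, ← ofReal_sub, norm_real, Real.norm_eq_abs, abs_le] at h2
  exact ⟨v, hv, by linarith [h2.1], by linarith [h2.2]⟩

end IsStandardized

end

/-! ### The saddle point expansion of the inversion integral -/

section

variable {Ω : Type*} [MeasurableSpace Ω]

open Complex Metric Topology

/-- Taylor's formula of order four for a holomorphic function bounded by `1`, with Cauchy's
estimates for the coefficients. -/
lemma norm_sub_taylor_le {f : ℂ → ℂ} {c w : ℂ} {ρ R : ℝ} (hρ : 0 < ρ) (hρR : ρ < R)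
    (hf : DifferentiableOn ℂ f (ball c R)) (hb : ∀ z ∈ sphere c ρ, ‖f z‖ ≤ 1)
    (hw : ‖w‖ ≤ ρ / 2) :
    ‖f (c + w) - (f c + deriv f c * w + deriv (deriv f) c / 2 * w ^ 2 +
      iteratedDeriv 3 f c / 6 * w ^ 3)‖ ≤ 2 * (‖w‖ / ρ) ^ 4 ∧
    ‖iteratedDeriv 3 f c / 6‖ ≤ 1 / ρ ^ 3 := by
  have hcl : DiffContOnCl ℂ f (ball c ρ) :=
    (hf.mono (by rw [closure_ball c hρ.ne']; exact closedBall_subset_ball hρR)).diffContOnCl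
  have hco : ∀ k : ℕ, ‖iteratedDeriv k f c / k.factorial‖ ≤ 1 / ρ ^ k := by
    intro k
    have h := norm_iteratedDeriv_le_of_forall_mem_sphere_norm_le k hρ hcl hb
    rw [mul_one] at h
    rw [norm_div, norm_natCast, div_le_iff₀ (by positivity)]
    exact h.trans_eq (by ring)
  refine ⟨?_, by simpa [Nat.factorial] using hco 3⟩
  have hmem : c + w ∈ ball c R := by
    rw [mem_ball_iff_norm, add_sub_cancel_left]; linarith
  have hs := (hasSum_nat_add_iff' 4).mpr (hasSum_taylorSeries_on_ball hf hmem)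
  have hq : ‖w‖ / ρ ≤ 1 / 2 := by rw [div_le_iff₀ hρ]; linarith
  have hq0 : 0 ≤ ‖w‖ / ρ := by positivity
  have hg := (hasSum_geometric_of_lt_one hq0 (by linarith)).mul_left ((‖w‖ / ρ) ^ 4)
  have hle := hs.norm_le_of_bounded hg fun k => ?_
  · have e : f (c + w) - (f c + deriv f c * w + deriv (deriv f) c / 2 * w ^ 2 +
        iteratedDeriv 3 f c / 6 * w ^ 3) = f (c + w) - ∑ i ∈ Finset.range 4,
          (i.factorial : ℂ)⁻¹ • (c + w - c) ^ i • iteratedDeriv i f c := by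
      simp only [Finset.sum_range_succ, Finset.range_zero, Finset.sum_empty, add_sub_cancel_left,
        smul_eq_mul, iteratedDeriv_zero, iteratedDeriv_one,
        show iteratedDeriv 2 f = deriv (deriv f) by rw [iteratedDeriv_succ, iteratedDeriv_one]]
      norm_num [Nat.factorial]
      ring
    rw [e]
    refine hle.trans ?_
    rw [mul_comm]
    gcongr
    rw [inv_le_comm₀ (by linarith) (by norm_num)]
    linarith
  · simp only [add_sub_cancel_left, smul_eq_mul]
    have h4 := hco (k + 4)
    calc ‖((k + 4).factorial : ℂ)⁻¹ * (w ^ (k + 4) * iteratedDeriv (k + 4) f c)‖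
        = ‖w‖ ^ (k + 4) * ‖iteratedDeriv (k + 4) f c / (k + 4).factorial‖ := by
          rw [norm_mul, norm_mul, norm_pow, norm_div, norm_inv]; ring
      _ ≤ ‖w‖ ^ (k + 4) * (1 / ρ ^ (k + 4)) := by gcongr
      _ = (‖w‖ / ρ) ^ 4 * (‖w‖ / ρ) ^ k := by rw [← pow_add, div_pow, add_comm 4 k]; ring

/-- The saddle point expansion of the integrand: the cubic term of the exponent is kept to first
order, everything else is an error of order `α⁻⁶ / N²`. -/
lemma IsStandardized.exists_norm_exp_sub_le {X : Ω → ℝ} {P : Measure Ω} [IsProbabilityMeasure P]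
    {α : ℝ} (hX : IsStandardized X P α) {h τ v N : ℝ} (hh : |h| ≤ α ^ 3 / 16)
    (hτ : deriv (logLaplace X P) h = τ) (hv : deriv (deriv (logLaplace X P)) h = v)
    (hv2 : 1 / 2 ≤ v) (hN : 0 < N) :
    ∃ a : ℂ, ‖a‖ ≤ 64 / (α ^ 3 * N) ∧ ∀ t : ℝ, |t| ≤ α ^ 3 / 1024 * N →
      ‖cexp (N ^ 2 *
          (logLaplace X P (h + (t / N : ℝ) * I) - logLaplace X P h - (t / N : ℝ) * I * τ)) -
        Real.exp (-v / 2 * t ^ 2) * (1 + a * t ^ 3)‖ ≤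
      Real.exp (-(1 / 8) * t ^ 2) * (16384 * t ^ 6 + 1024 * t ^ 4) / (α ^ 6 * N ^ 2) := by
  have hα := hX.pos
  have h8 := hX.cube_div_le
  have hα2 := hX.sq_le_two
  set K := logLaplace X P with hK
  have hTay : ∀ w : ℂ, ‖w‖ ≤ (α / 4) / 2 → _ := fun w hw =>
    norm_sub_taylor_le (f := K) (c := (h : ℂ)) (w := w) (ρ := α / 4) (R := α / 4 + α / 8)
      (by positivity) (by linarith) (hX.differentiableOn_logLaplace.mono (fun z hz => by
        rw [mem_ball_iff_norm] at hz
        rw [mem_ball_zero_iff]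
        have h1 := norm_sub_norm_le z h
        have h2 : ‖(h : ℂ)‖ = |h| := norm_real h
        linarith)) (fun z hz => hX.norm_logLaplace_le (by
        rw [mem_sphere_iff_norm] at hz
        have h1 := norm_sub_norm_le z h
        have h2 : ‖(h : ℂ)‖ = |h| := norm_real h
        linarith)) hw
  set k3 : ℂ := iteratedDeriv 3 K h / 6 with hk3
  have hk3b : ‖k3‖ ≤ 64 / α ^ 3 :=
    (hTay 0 (by simp; positivity)).2.trans_eq (by field_simp; norm_num)
  have haN : ‖k3 * I ^ 3 / N‖ ≤ 64 / (α ^ 3 * N) := by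
    rw [norm_div, norm_mul, norm_pow, norm_I, one_pow, mul_one, norm_real,
      Real.norm_of_nonneg hN.le, ← div_div]
    gcongr
  refine ⟨k3 * I ^ 3 / N, haN, fun t ht => ?_⟩
  set a := k3 * I ^ 3 / N with ha
  set s : ℝ := t / N with hs
  have hst : |s| = |t| / N := by rw [hs, abs_div, abs_of_pos hN]
  have hs1 : |t| / N ≤ α ^ 3 / 1024 := by rw [div_le_iff₀ hN]; exact ht
  have hwn : ‖(s : ℂ) * I‖ = |t| / N := by rw [norm_mul, norm_I, mul_one, norm_real, ← hst]; rfl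
  have hR := (hTay ((s : ℂ) * I) (by rw [hwn]; linarith)).1
  rw [hwn, hτ, hv] at hR
  set R := K (h + s * I) - (K h + τ * (s * I) + v / 2 * (s * I) ^ 2 + k3 * (s * I) ^ 3) with hRdef
  set E : ℂ := N ^ 2 * R with hE
  have hNC : (N : ℂ) ≠ 0 := by exact_mod_cast hN.ne'
  have hexp : (N : ℂ) ^ 2 * (K (h + s * I) - K h - s * I * τ) =
      ((-v / 2 * t ^ 2 : ℝ) : ℂ) + (a * t ^ 3 + E) := by
    have hsC : (s : ℂ) = t / N := by rw [hs]; push_cast; rfl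
    rw [hE, hRdef, ha]
    push_cast
    rw [show (t : ℂ) = s * N by rw [hsC]; field_simp]
    field_simp
    ring_nf
    simp
  rw [hexp, Complex.exp_add, ofReal_exp, ← mul_sub, norm_mul, ← ofReal_exp, norm_real,
    Real.norm_of_nonneg (Real.exp_pos _).le]
  set w : ℂ := a * t ^ 3 + E with hw
  have hEb : ‖E‖ ≤ 512 * |t| ^ 4 / (α ^ 4 * N ^ 2) := by
    rw [hE, norm_mul, norm_pow, norm_real, Real.norm_of_nonneg hN.le]
    calc N ^ 2 * ‖R‖ ≤ N ^ 2 * (2 * (|t| / N / (α / 4)) ^ 4) := by gcongr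
      _ = _ := by field_simp; ring
  have hEb1 : ‖E‖ ≤ 1024 * t ^ 4 / (α ^ 6 * N ^ 2) := by
    refine hEb.trans ?_
    rw [← abs_of_nonneg (show 0 ≤ t ^ 4 by positivity), abs_pow,
      div_le_div_iff₀ (by positivity) (by positivity)]
    have : 512 * |t| ^ 4 * (α ^ 6 * N ^ 2) = 512 * |t| ^ 4 * (α ^ 4 * N ^ 2) * α ^ 2 := by ring
    rw [this]
    have h0 : 0 ≤ 512 * |t| ^ 4 * (α ^ 4 * N ^ 2) := by positivity
    nlinarith
  have hEb2 : ‖E‖ ≤ |t| ^ 3 / (α ^ 3 * N) := by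
    refine hEb.trans ?_
    calc 512 * |t| ^ 4 / (α ^ 4 * N ^ 2) = 512 * |t| ^ 3 / (α ^ 4 * N) * (|t| / N) := by
          field_simp
      _ ≤ 512 * |t| ^ 3 / (α ^ 4 * N) * (α ^ 3 / 1024) := by gcongr
      _ = |t| ^ 3 / (α ^ 3 * N) * (α ^ 2 / 2) := by field_simp; ring
      _ ≤ |t| ^ 3 / (α ^ 3 * N) * 1 := by gcongr; linarith
      _ = _ := mul_one _
  have hat : ‖a * t ^ 3‖ ≤ 64 * (|t| ^ 3 / (α ^ 3 * N)) := by
    rw [norm_mul, norm_pow, norm_real, Real.norm_eq_abs]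
    calc ‖a‖ * |t| ^ 3 ≤ 64 / (α ^ 3 * N) * |t| ^ 3 := by gcongr
      _ = _ := by ring
  have hwb : ‖w‖ ≤ 128 * (|t| ^ 3 / (α ^ 3 * N)) := by
    have h0 : 0 ≤ |t| ^ 3 / (α ^ 3 * N) := by positivity
    refine (norm_add_le _ _).trans ?_
    linarith
  have hw2 : ‖w‖ ^ 2 ≤ 16384 * t ^ 6 / (α ^ 6 * N ^ 2) := by
    calc ‖w‖ ^ 2 ≤ (128 * (|t| ^ 3 / (α ^ 3 * N))) ^ 2 := by gcongr
      _ = 16384 * |t| ^ 6 / (α ^ 6 * N ^ 2) := by field_simp; ring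
      _ = _ := by rw [← abs_pow, abs_of_nonneg (by positivity)]
  have hw1 : ‖w‖ ≤ t ^ 2 / 8 := by
    refine hwb.trans ?_
    calc 128 * (|t| ^ 3 / (α ^ 3 * N)) = 128 * |t| ^ 2 / α ^ 3 * (|t| / N) := by field_simp
      _ ≤ 128 * |t| ^ 2 / α ^ 3 * (α ^ 3 / 1024) := by gcongr
      _ = _ := by rw [sq_abs]; field_simp; ring
  have hmain : ‖cexp w - (1 + a * t ^ 3)‖ ≤
      Real.exp (t ^ 2 / 8) * ((16384 * t ^ 6 + 1024 * t ^ 4) / (α ^ 6 * N ^ 2)) := by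
    have h2 := norm_exp_sub_sum_le_norm_mul_exp w 2
    simp only [Finset.sum_range_succ, Finset.range_zero, Finset.sum_empty, pow_zero,
      Nat.factorial_zero, Nat.cast_one, div_one, zero_add, pow_one, Nat.factorial_one] at h2
    have h3 : cexp w - (1 + a * t ^ 3) = (cexp w - (1 + w)) + E := by rw [hw]; ring
    have h4 : Real.exp ‖w‖ ≤ Real.exp (t ^ 2 / 8) := Real.exp_le_exp.mpr hw1
    have h5 : 1 ≤ Real.exp (t ^ 2 / 8) := Real.one_le_exp (by positivity)
    rw [h3]
    calc _ ≤ ‖w‖ ^ 2 * Real.exp ‖w‖ + ‖E‖ := (norm_add_le _ _).trans (by gcongr)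
      _ ≤ 16384 * t ^ 6 / (α ^ 6 * N ^ 2) * Real.exp (t ^ 2 / 8) +
          1024 * t ^ 4 / (α ^ 6 * N ^ 2) * Real.exp (t ^ 2 / 8) := by
          gcongr
          exact hEb1.trans (le_mul_of_one_le_right (by positivity) h5)
      _ = _ := by ring
  calc Real.exp (-v / 2 * t ^ 2) * ‖cexp w - (1 + a * t ^ 3)‖
      ≤ Real.exp (-(1 / 4) * t ^ 2) * (Real.exp (t ^ 2 / 8) *
        ((16384 * t ^ 6 + 1024 * t ^ 4) / (α ^ 6 * N ^ 2))) := by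
        gcongr
        nlinarith [sq_nonneg t]
    _ = _ := by
        rw [← mul_assoc, ← Real.exp_add, mul_div_assoc]
        ring_nf

lemma integrable_pow_mul_exp_neg_sq {b : ℝ} (hb : 0 < b) (k : ℕ) :
    Integrable (fun t : ℝ => t ^ k * Real.exp (-b * t ^ 2)) := by
  have := integrable_rpow_mul_exp_neg_mul_sq hb (s := k)
    (lt_of_lt_of_le (by norm_num) (Nat.cast_nonneg k))
  simpa only [Real.rpow_natCast] using this

lemma integral_gaussian_mul_one_add_cube {v : ℝ} (hv : 0 < v) (a : ℂ) :
    Integrable (fun t : ℝ => (Real.exp (-v / 2 * t ^ 2) : ℂ) * (1 + a * t ^ 3)) ∧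
    ∫ t : ℝ, (Real.exp (-v / 2 * t ^ 2) : ℂ) * (1 + a * t ^ 3) =
      ((√(2 * Real.pi / v) : ℝ) : ℂ) := by
  have h0 : Integrable (fun t : ℝ => Real.exp (-v / 2 * t ^ 2)) := by
    simpa [neg_div] using integrable_pow_mul_exp_neg_sq (half_pos hv) 0
  have h3 : Integrable (fun t : ℝ => t ^ 3 * Real.exp (-v / 2 * t ^ 2)) := by
    simpa only [neg_div] using integrable_pow_mul_exp_neg_sq (half_pos hv) 3
  have hodd : ∫ t : ℝ, t ^ 3 * Real.exp (-v / 2 * t ^ 2) = 0 := by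
    have := integral_neg_eq_self (fun t : ℝ => t ^ 3 * Real.exp (-v / 2 * t ^ 2)) volume
    have e (t : ℝ) : (-t) ^ 3 * Real.exp (-v / 2 * (-t) ^ 2) =
        -(t ^ 3 * Real.exp (-v / 2 * t ^ 2)) := by rw [neg_sq]; ring
    simp_rw [e, integral_neg] at this
    linarith
  have e : ∀ t : ℝ, (Real.exp (-v / 2 * t ^ 2) : ℂ) * (1 + a * t ^ 3) =
      ((Real.exp (-v / 2 * t ^ 2) : ℝ) : ℂ) +
        a * ((t ^ 3 * Real.exp (-v / 2 * t ^ 2) : ℝ) : ℂ) := by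
    intro t; push_cast; ring
  have i0 : Integrable (fun t : ℝ => ((Real.exp (-v / 2 * t ^ 2) : ℝ) : ℂ)) := h0.ofReal
  have i3 : Integrable (fun t : ℝ => a * ((t ^ 3 * Real.exp (-v / 2 * t ^ 2) : ℝ) : ℂ)) :=
    h3.ofReal.const_mul a
  simp_rw [e]
  have i03 := i0.add i3
  refine ⟨i03, ?_⟩
  rw [integral_add i0 i3, integral_const_mul, integral_complex_ofReal, integral_complex_ofReal,
    hodd, neg_div]
  rw [integral_gaussian (v / 2)]
  simp only [ofReal_zero, mul_zero, add_zero]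
  congr 2
  field_simp

/-- The Gaussian moment bounding the error term of the saddle point expansion. -/
noncomputable def gaussMoment : ℝ :=
  ∫ t : ℝ, Real.exp (-(1 / 8) * t ^ 2) * (t ^ 2 + t ^ 4 + t ^ 6)

lemma integrable_gaussMoment :
    Integrable (fun t : ℝ => Real.exp (-(1 / 8) * t ^ 2) * (t ^ 2 + t ^ 4 + t ^ 6)) := by
  have h := fun k => integrable_pow_mul_exp_neg_sq (show (0 : ℝ) < 1 / 8 by norm_num) k
  refine (((h 2).add (h 4)).add (h 6)).congr (.of_forall fun t => ?_)
  simp only [Pi.add_apply]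
  ring

lemma gaussMoment_nonneg : 0 ≤ gaussMoment :=
  integral_nonneg fun t => by positivity

/-- An integrand that follows the saddle point expansion on `|t| ≤ α³N/1024` has almost the
Gaussian integral, up to its own tail. -/
lemma norm_integral_sub_gaussian_le {F : ℝ → ℂ} (hF : Integrable F) {α v N : ℝ} {a : ℂ}
    (hα : 0 < α) (hv : 1 / 2 ≤ v) (hN : 0 < N) (ha : ‖a‖ ≤ 64 / (α ^ 3 * N))
    (hFt : ∀ t : ℝ, |t| ≤ α ^ 3 / 1024 * N →
      ‖F t - Real.exp (-v / 2 * t ^ 2) * (1 + a * t ^ 3)‖ ≤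
      Real.exp (-(1 / 8) * t ^ 2) * (16384 * t ^ 6 + 1024 * t ^ 4) / (α ^ 6 * N ^ 2)) :
    ‖(∫ t, F t) - ((√(2 * Real.pi / v) : ℝ) : ℂ)‖ ≤ 2 ^ 20 * gaussMoment / (α ^ 6 * N ^ 2) +
      ∫ t in {t : ℝ | α ^ 3 / 1024 * N < |t|}, ‖F t‖ := by
  obtain ⟨hi, hI⟩ := integral_gaussian_mul_one_add_cube (by linarith : 0 < v) a
  have hms : MeasurableSet {t : ℝ | α ^ 3 / 1024 * N < |t|} :=
    measurableSet_lt measurable_const (by fun_prop)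
  set S := {t : ℝ | α ^ 3 / 1024 * N < |t|} with hS
  have hbi : Integrable (fun t : ℝ => 2 ^ 20 / (α ^ 6 * N ^ 2) *
      (Real.exp (-(1 / 8) * t ^ 2) * (t ^ 2 + t ^ 4 + t ^ 6))) :=
    integrable_gaussMoment.const_mul _
  have hind : Integrable (S.indicator fun t => ‖F t‖) := hF.norm.indicator hms
  rw [← hI, ← integral_sub hF hi]
  calc _ ≤ ∫ t : ℝ, (2 ^ 20 / (α ^ 6 * N ^ 2) *
      (Real.exp (-(1 / 8) * t ^ 2) * (t ^ 2 + t ^ 4 + t ^ 6)) +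
      S.indicator (fun t => ‖F t‖) t) := by
        refine norm_integral_le_of_norm_le (hbi.add hind) (.of_forall fun t => ?_)
        by_cases ht : t ∈ S
        · rw [Set.indicator_of_mem ht]
          refine (norm_sub_le _ _).trans ((add_comm _ _).le.trans (add_le_add ?_ le_rfl))
          rw [hS, Set.mem_ofPred_eq] at ht
          have h1 : 1 ≤ 1024 * |t| / (α ^ 3 * N) := by
            rw [le_div_iff₀ (by positivity)]; linarith
          rw [norm_mul, norm_real, Real.norm_of_nonneg (Real.exp_pos _).le]
          have h2 : ‖1 + a * t ^ 3‖ ≤ 2 ^ 20 / (α ^ 6 * N ^ 2) * (t ^ 2 + t ^ 4) := by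
            have h3 : ‖a * t ^ 3‖ ≤ 64 / (α ^ 3 * N) * |t| ^ 3 := by
              rw [norm_mul, norm_pow, norm_real, Real.norm_eq_abs]; gcongr
            calc ‖1 + a * t ^ 3‖ ≤ 1 + 64 / (α ^ 3 * N) * |t| ^ 3 :=
                  (norm_add_le _ _).trans (by rw [norm_one]; gcongr)
              _ ≤ (1024 * |t| / (α ^ 3 * N)) ^ 2 + 64 / (α ^ 3 * N) * |t| ^ 3 *
                  (1024 * |t| / (α ^ 3 * N)) := by
                  exact add_le_add (one_le_pow₀ h1)
                    (le_mul_of_one_le_right (by positivity) h1)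
              _ = 2 ^ 20 * |t| ^ 2 / (α ^ 6 * N ^ 2) + 2 ^ 16 * |t| ^ 4 / (α ^ 6 * N ^ 2) := by
                  field_simp; ring
              _ ≤ 2 ^ 20 * |t| ^ 2 / (α ^ 6 * N ^ 2) + 2 ^ 20 * |t| ^ 4 / (α ^ 6 * N ^ 2) := by
                  gcongr <;> norm_num
              _ = _ := by
                  rw [← abs_pow, ← abs_pow, abs_of_nonneg (by positivity),
                    abs_of_nonneg (show 0 ≤ t ^ 4 by positivity)]
                  ring
          calc _ ≤ Real.exp (-(1 / 8) * t ^ 2) * (2 ^ 20 / (α ^ 6 * N ^ 2) * (t ^ 2 + t ^ 4)) := by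
                gcongr
                nlinarith [sq_nonneg t]
            _ ≤ Real.exp (-(1 / 8) * t ^ 2) * (2 ^ 20 / (α ^ 6 * N ^ 2) *
                (t ^ 2 + t ^ 4 + t ^ 6)) := by
                have : 0 ≤ t ^ 6 := by positivity
                exact mul_le_mul_of_nonneg_left (mul_le_mul_of_nonneg_left (by linarith)
                  (by positivity)) (Real.exp_pos _).le
            _ = _ := by ring
        · rw [Set.indicator_of_notMem ht, add_zero]
          refine (hFt t (not_lt.mp ht)).trans ?_
          rw [mul_div_assoc, mul_left_comm, div_mul_eq_mul_div]
          gcongr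
          have h2 : 0 ≤ t ^ 2 := by positivity
          have h4 : 0 ≤ t ^ 4 := by positivity
          have h6 : 0 ≤ t ^ 6 := by positivity
          linarith
    _ = _ := by
        rw [integral_add hbi hind, integral_const_mul, integral_indicator hms, gaussMoment]
        ring

end

/-! ### Normalized sums of independent copies -/

section

variable {Ω : Type*} [MeasurableSpace Ω]

open Complex Metric Topology

variable {X : ℕ → Ω → ℝ} {P : Measure Ω}

lemma aemeasurable_normalizedSum (hX : ∀ i, AEMeasurable (X i) P) (n : ℕ) :
    AEMeasurable (normalizedSum X n) P := by
  unfold normalizedSum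
  exact (Finset.aemeasurable_fun_sum _ fun i _ => hX i).div_const _

/-- The Laplace transform of a normalized sum of independent copies is a power. -/
lemma complexMGF_normalizedSum (hind : iIndepFun X P)
    (hid : ∀ i, IdentDistrib (X i) (X 0) P P) (n : ℕ) (z : ℂ) :
    complexMGF id (P.map (normalizedSum X n)) z = complexMGF (X 0) P (z / √(n : ℝ)) ^ n := by
  rw [complexMGF_id_map (aemeasurable_normalizedSum (fun i => (hid i).aemeasurable_fst) n)]
  have h := (hind.precomp (Fin.val_injective (n := n))).integral_fun_prod_comp
    (f := fun _ (x : ℝ) => cexp (z / √(n : ℝ) * x)) (fun i => (hid i).aemeasurable_fst)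
    (fun i => by fun_prop)
  have h2 : ∀ i : Fin n, ∫ ω, cexp (z / √(n : ℝ) * X i ω) ∂P
      = complexMGF (X 0) P (z / √(n : ℝ)) := fun i => by
    rw [← complexMGF_congr_identDistrib (hid i)]; rfl
  simp only [h2, Finset.prod_const, Finset.card_univ, Fintype.card_fin] at h
  rw [← h, complexMGF]
  congr 1 with ω
  rw [← Complex.exp_sum, ← Finset.mul_sum, normalizedSum, Finset.sum_range]
  push_cast
  congr 1
  ring

lemma mgf_normalizedSum (hind : iIndepFun X P)
    (hid : ∀ i, IdentDistrib (X i) (X 0) P P) (n : ℕ) (h : ℝ) :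
    mgf id (P.map (normalizedSum X n)) h = mgf (X 0) P (h / √(n : ℝ)) ^ n := by
  have := complexMGF_normalizedSum hind hid n h
  rw [complexMGF_ofReal, ← ofReal_div, complexMGF_ofReal] at this
  exact_mod_cast this

-- A non-integrable exponential would have the junk integral `0`.
lemma integrable_of_mgf_ne_zero {m : Measure ℝ} {h : ℝ} (hm : mgf id m h ≠ 0) :
    Integrable (fun x => Real.exp (h * x)) m := by
  by_contra hc
  exact hm (integral_undef hc)

lemma integral_sq_normalizedSum [IsProbabilityMeasure P] {α : ℝ} (h0 : IsStandardized (X 0) P α)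
    (hind : iIndepFun X P)
    (hid : ∀ i, IdentDistrib (X i) (X 0) P P) {n : ℕ} (hn : 1 ≤ n) :
    Integrable (fun x => x ^ 2) (P.map (normalizedSum X n)) ∧
      ∫ x, x ^ 2 ∂P.map (normalizedSum X n) = 1 := by
  have hm := aemeasurable_normalizedSum (fun i => (hid i).aemeasurable_fst) n
  have h2 : MemLp (X 0) 2 P :=
    (memLp_two_iff_integrable_sq h0.aemeasurable.aestronglyMeasurable).2 h0.integrable_sq
  have hi : ∀ i, MemLp (X i) 2 P := fun i => (hid i).symm.memLp_snd h2
  have hS : MemLp (normalizedSum X n) 2 P := by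
    have := (memLp_finsetSum (Finset.range n) fun i _ => hi i).mul_const (√(n : ℝ))⁻¹
    exact this
  have hv := IndepFun.variance_sum (s := Finset.range n) (fun i _ => hi i)
    (fun i _ j _ hij => hind.indepFun hij)
  have hv0 : Var[X 0; P] = 1 := by
    rw [variance_eq_sub h2, h0.integral_eq]
    simpa using h0.integral_sq
  simp only [fun i => (hid i).variance_eq, hv0, Finset.sum_const, Finset.card_range,
    nsmul_eq_mul, mul_one] at hv
  have he : ∫ ω, (∑ i ∈ Finset.range n, X i) ω ∂P = 0 := by
    simp only [Finset.sum_apply]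
    rw [integral_finsetSum _ fun i _ => (hi i).integrable one_le_two]
    simp [fun i => (hid i).integral_eq, h0.integral_eq]
  rw [variance_eq_sub (memLp_finsetSum' _ fun i _ => hi i), he] at hv
  constructor
  · rw [integrable_map_measure (by fun_prop) hm]
    exact hS.integrable_sq
  · rw [integral_map hm (by fun_prop)]
    have : ∀ ω, normalizedSum X n ω ^ 2 = (∑ i ∈ Finset.range n, X i ω) ^ 2 / n := fun ω => by
      rw [normalizedSum, div_pow, Real.sq_sqrt (Nat.cast_nonneg n)]
    simp only [this, integral_div]
    have hn' : (n : ℝ) ≠ 0 := by positivity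
    rw [div_eq_one_iff_eq hn']
    simpa using hv

lemma map_const_mul_absolutelyContinuous {f : Ω → ℝ} (hf : AEMeasurable f P)
    (h : P.map f ≪ volume) {c : ℝ} (hc : c ≠ 0) : P.map (fun ω => c * f ω) ≪ volume := by
  have h1 := h.map (measurable_const_mul c)
  rw [Real.map_volume_mul_left hc,
    AEMeasurable.map_map_of_aemeasurable (by fun_prop) hf] at h1
  exact h1.trans (Measure.smul_absolutelyContinuous)

/-- Adding independent summands preserves absolute continuity. -/
lemma map_normalizedSum_absolutelyContinuous [IsProbabilityMeasure P] (hind : iIndepFun X P)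
    (hX : ∀ i, AEMeasurable (X i) P) {n₀ n : ℕ} (h1 : 1 ≤ n₀) (hn : n₀ ≤ n)
    (h : P.map (normalizedSum X n₀) ≪ volume) : P.map (normalizedSum X n) ≪ volume := by
  have hm := aemeasurable_normalizedSum hX n₀
  have hS0 := map_const_mul_absolutelyContinuous hm h
    (c := √(n₀ : ℝ)) (by positivity)
  have hS : ∀ k : ℕ, AEMeasurable (∑ i ∈ Finset.range k, X i) P := fun k =>
    Finset.aemeasurable_sum _ fun i _ => hX i
  have hT : AEMeasurable (∑ i ∈ Finset.Ico n₀ n, X i) P :=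
    Finset.aemeasurable_sum _ fun i _ => hX i
  have e0 : (fun ω => √(n₀ : ℝ) * normalizedSum X n₀ ω) = ∑ i ∈ Finset.range n₀, X i := by
    ext ω
    simp only [normalizedSum, Finset.sum_apply]
    field_simp
  rw [e0] at hS0
  have hI : (∑ i ∈ Finset.range n₀, X i) ⟂ᵢ[P] (∑ i ∈ Finset.Ico n₀ n, X i) := by
    have hd : Disjoint (Finset.range n₀) (Finset.Ico n₀ n) := by
      rw [Finset.range_eq_Ico]; exact Finset.Ico_disjoint_Ico_consecutive 0 n₀ n
    have := (hind.indepFun_finset₀ _ _ hd hX).comp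
      (φ := fun f : (Finset.range n₀) → ℝ => ∑ i, f i)
      (ψ := fun f : (Finset.Ico n₀ n) → ℝ => ∑ i, f i) (by fun_prop) (by fun_prop)
    convert! this using 1
    · ext ω
      simp only [Finset.sum_apply, Function.comp_def]
      exact (Finset.sum_coe_sort (Finset.range n₀) fun i => X i ω).symm
    · ext ω
      simp only [Finset.sum_apply, Function.comp_def]
      exact (Finset.sum_coe_sort (Finset.Ico n₀ n) fun i => X i ω).symm
  have hsum := hI.symm.map_add_eq_map_conv_map₀ hT (hS n₀)
  have hac : P.map (∑ i ∈ Finset.range n, X i) ≪ volume := by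
    rw [← Finset.sum_range_add_sum_Ico _ hn, add_comm, hsum]
    exact Measure.conv_absolutelyContinuous hS0
  have := map_const_mul_absolutelyContinuous (hS n) hac (c := (√(n : ℝ))⁻¹)
    (by have : 0 < n := by omega
        positivity)
  convert! this using 2
  ext ω
  simp [normalizedSum, div_eq_inv_mul]

end

/-! ### Exponential tilting -/

section

variable {Ω : Type*} [MeasurableSpace Ω]

open Complex Metric Topology

lemma IsDensity.absolutelyContinuous {m : Measure ℝ} {q : ℝ → ℝ} (hq : IsDensity m q) :
    m ≪ volume := by
  rw [hq.2.2]; exact withDensity_absolutelyContinuous _ _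

lemma charFun_tilted {m : Measure ℝ} (H t : ℝ) :
    charFun (m.tilted fun x => H * x) t = complexMGF id m (H + t * I) / mgf id m H := by
  rw [charFun_apply_real, integral_tilted, complexMGF, ← integral_div]
  congr 1 with x
  simp only [mgf, id, Complex.real_smul]
  push_cast
  rw [div_mul_eq_mul_div, ← Complex.exp_add]
  congr 2
  ring

/-- Fourier inversion along the vertical line through `H`, that is, for the density of the
exponentially tilted measure. -/
lemma IsDensity.eq_integral_complexMGF {m : Measure ℝ} [IsProbabilityMeasure m] {p : ℝ → ℝ}
    (hp : IsDensity m p) (hpc : Continuous p) {H : ℝ}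
    (hH : Integrable (fun x => Real.exp (H * x)) m)
    (hg : Integrable (fun t : ℝ => complexMGF id m (H + t * I))) (x : ℝ) :
    (p x : ℂ) = cexp (-(H * x)) * ((2 * Real.pi)⁻¹ *
      ∫ t : ℝ, cexp (-(t * x * I)) * complexMGF id m (H + t * I)) := by
  have hpos : 0 < mgf id m H := mgf_pos hH
  have := isProbabilityMeasure_tilted hH
  have hch : charFun (m.tilted fun x => H * x)
      = fun t : ℝ => complexMGF id m (H + t * I) / mgf id m H := by
    ext t; exact charFun_tilted H t
  obtain ⟨p', hp', hpc', -, hinv⟩ := exists_density_of_integrable_charFun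
    (m := m.tilted fun x => H * x)
    ((tilted_absolutelyContinuous _ _).trans hp.absolutelyContinuous)
    (by rw [hch]; exact hg.div_const _)
  have hE : p' = fun x => p x * (Real.exp (H * x) / mgf id m H) := by
    have hm1 : Measurable fun x : ℝ => ENNReal.ofReal (Real.exp (H * x) / mgf id m H) := by
      fun_prop
    have h1 : m.tilted (fun x => H * x) = volume.withDensity
        (fun x => ENNReal.ofReal (p x * (Real.exp (H * x) / mgf id m H))) := by
      have : (fun x => ENNReal.ofReal (p x * (Real.exp (H * x) / mgf id m H)))
          = (fun x => ENNReal.ofReal (p x)) *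
            fun x => ENNReal.ofReal (Real.exp (H * x) / mgf id m H) := by
        ext x; exact ENNReal.ofReal_mul (hp.2.1 x)
      rw [this, withDensity_mul _ hp.1.ennreal_ofReal hm1, ← hp.2.2]
      rfl
    rw [hp'.2.2, withDensity_eq_iff_of_sigmaFinite hp'.1.ennreal_ofReal.aemeasurable
      (by have := hp.1; fun_prop)] at h1
    have h2 : p' =ᵐ[volume] fun x => p x * (Real.exp (H * x) / mgf id m H) := by
      filter_upwards [h1] with x hx
      exact (ENNReal.ofReal_eq_ofReal_iff (hp'.2.1 x)
        (mul_nonneg (hp.2.1 x) (by positivity))).1 hx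
    exact (Continuous.ae_eq_iff_eq volume hpc' (by fun_prop)).1 h2
  have h3 : p x = Real.exp (-(H * x)) * mgf id m H * p' x := by
    rw [hE, Real.exp_neg]
    have := (Real.exp_pos (H * x)).ne'
    have := hpos.ne'
    field_simp
  rw [h3]
  push_cast
  rw [hinv, hch]
  simp only [← mul_div_assoc, integral_div]
  have : (mgf id m H : ℂ) ≠ 0 := by exact_mod_cast hpos.ne'
  push_cast
  generalize ∫ t : ℝ, cexp (-(t * x * I)) * complexMGF id m (H + t * I) = J
  field_simp

namespace IsStandardized

variable {X : Ω → ℝ} {P : Measure Ω} {α : ℝ} (hX : IsStandardized X P α)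
include hX

lemma continuous_complexMGF {h : ℝ} (hh : |h| < α) :
    Continuous fun t : ℝ => complexMGF X P (h + t * I) := by
  rw [continuous_iff_continuousAt]
  intro t
  have h1 : ((h : ℂ) + t * I).re ∈ interior (integrableExpSet X P) := by
    have := hX.re_mem_interior (z := h) (by simpa using hh)
    simpa using this
  exact ContinuousAt.comp (f := fun t : ℝ => (h : ℂ) + t * I)
    (ProbabilityTheory.hasDerivAt_complexMGF h1).continuousAt (by fun_prop)

variable [IsProbabilityMeasure P]

lemma one_le_mgf {h : ℝ} (hh : |h| ≤ α) : 1 ≤ mgf X P h := by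
  have h1 := hX.integrable_exp_mul hh
  calc (1 : ℝ) = ∫ ω, (1 + h * X ω) ∂P := by
        rw [integral_add (integrable_const _) (hX.integrable_self.const_mul _), integral_const_mul,
          hX.integral_eq]
        simp
    _ ≤ _ := integral_mono ((integrable_const _).add (hX.integrable_self.const_mul _)) h1
        fun ω => by simpa [add_comm] using Real.add_one_le_exp (h * X ω)

lemma mgf_le {h : ℝ} (hh : |h| ≤ α / 8) : mgf X P h ≤ 1 + 2 * h ^ 2 / α ^ 2 := by
  have h1 := hX.norm_complexMGF_sub_one_le (z := h) (by simpa using hh)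
  rw [complexMGF_ofReal, ← ofReal_one, ← ofReal_sub, norm_real, norm_real] at h1
  simp only [Real.norm_eq_abs, sq_abs] at h1
  linarith [le_abs_self (mgf X P h - 1)]

lemma mgf_pow_le_two {h : ℝ} {n : ℕ} (hh : |h| ≤ α / 8) (hn : n * (4 * h ^ 2) ≤ α ^ 2) :
    mgf X P h ^ n ≤ 2 := by
  have hα := hX.pos
  have h1 : mgf X P h ≤ Real.exp (2 * h ^ 2 / α ^ 2) :=
    (hX.mgf_le hh).trans (by linarith [Real.add_one_le_exp (2 * h ^ 2 / α ^ 2)])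
  have h0 : 0 ≤ mgf X P h := mgf_nonneg
  calc mgf X P h ^ n ≤ Real.exp (2 * h ^ 2 / α ^ 2) ^ n := by gcongr
    _ = Real.exp (n * (4 * h ^ 2) / α ^ 2 / 2) := by rw [← Real.exp_nat_mul]; ring_nf
    _ ≤ Real.exp (1 / 2) := by
        gcongr
        rw [div_le_one (by positivity)]; exact hn
    _ ≤ 2 := by
        have h2 : Real.exp (1 / 2) ^ 2 = Real.exp 1 := by rw [← Real.exp_nat_mul]; norm_num
        nlinarith [Real.exp_one_lt_d9, Real.exp_pos (1 / 2)]

end IsStandardized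

end

/-! ### Decay of the tilted characteristic function -/

section

variable {Ω : Type*} [MeasurableSpace Ω]

open Complex Metric Topology

/-- The characteristic function of the law of `X` tilted by `e^{hx}`, the Cramér transform. -/
noncomputable def tiltedCharFun (X : Ω → ℝ) (P : Measure Ω) (h s : ℝ) : ℂ :=
  complexMGF X P (h + s * I) / mgf X P h

lemma norm_tiltedCharFun (X : Ω → ℝ) (P : Measure Ω) (h s : ℝ) :
    ‖tiltedCharFun X P h s‖ = ‖complexMGF X P (h + s * I)‖ / mgf X P h := by
  rw [tiltedCharFun, norm_div, norm_real, Real.norm_of_nonneg mgf_nonneg]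

lemma norm_tiltedCharFun_le_one (X : Ω → ℝ) (P : Measure Ω) (h s : ℝ) :
    ‖tiltedCharFun X P h s‖ ≤ 1 := by
  rw [norm_tiltedCharFun]
  refine div_le_one_of_le₀ ?_ mgf_nonneg
  simpa using norm_complexMGF_le_mgf (X := X) (μ := P) (z := (h : ℂ) + s * I)

/-- Independent copies of a standardized random variable, some normalized sum of which has a
density bounded by `M`. -/
structure IsIIDWithDensity (X : ℕ → Ω → ℝ) (P : Measure Ω) (α M : ℝ) (n₀ : ℕ) : Prop where
  isStandardized : IsStandardized (X 0) P α
  iIndepFun : iIndepFun X P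
  identDistrib : ∀ i, IdentDistrib (X i) (X 0) P P
  one_le : 1 ≤ n₀
  exists_density : ∃ q : ℝ → ℝ, IsDensity (P.map (normalizedSum X n₀)) q ∧ ∀ x, q x ≤ M

namespace IsIIDWithDensity

variable {X : ℕ → Ω → ℝ} {P : Measure Ω} {α M : ℝ} {n₀ : ℕ}
  (hX : IsIIDWithDensity X P α M n₀)
include hX

lemma aemeasurable (i : ℕ) : AEMeasurable (X i) P := (hX.identDistrib i).aemeasurable_fst

lemma sqrt_pos : 0 < √(n₀ : ℝ) :=
  Real.sqrt_pos.2 (by exact_mod_cast hX.one_le)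

lemma complexMGF_normalizedSum_line {n : ℕ} (hn : 0 < n) (h t : ℝ) :
    complexMGF id (P.map (normalizedSum X n)) ((h * √(n : ℝ) : ℝ) + t * I) =
      complexMGF (X 0) P (h + (t / √(n : ℝ) : ℝ) * I) ^ n := by
  rw [complexMGF_normalizedSum hX.iIndepFun hX.identDistrib]
  congr 2
  have : (√(n : ℝ) : ℂ) ≠ 0 := by
    exact_mod_cast (Real.sqrt_pos.2 (by exact_mod_cast hn)).ne'
  push_cast
  field_simp

lemma mgf_normalizedSum_line {n : ℕ} (hn : 0 < n) (h : ℝ) :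
    mgf id (P.map (normalizedSum X n)) (h * √(n : ℝ)) = mgf (X 0) P h ^ n := by
  rw [mgf_normalizedSum hX.iIndepFun hX.identDistrib, mul_div_cancel_right₀]
  exact (Real.sqrt_pos.2 (by exact_mod_cast hn)).ne'

variable [IsProbabilityMeasure P]

lemma isProbabilityMeasure_map (n : ℕ) : IsProbabilityMeasure (P.map (normalizedSum X n)) :=
  Measure.isProbabilityMeasure_map (aemeasurable_normalizedSum hX.aemeasurable n)

lemma three_sixteenths_le : 3 / 16 ≤ M := by
  obtain ⟨q, hq, hM⟩ := hX.exists_density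
  have := hX.isProbabilityMeasure_map n₀
  obtain ⟨hi, h2⟩ := integral_sq_normalizedSum hX.isStandardized hX.iIndepFun hX.identDistrib
    hX.one_le
  exact hq.three_sixteenths_le hM hi h2.le

/-- A tilt of the admissible size is small on the scale of `n₀` summands; here `29 M² ≥ 1`. -/
lemma abs_mul_le {h : ℝ} (hh : |h| ≤ α ^ 3 / (1000 * M ^ 2 * n₀)) :
    |h| * n₀ ≤ 29 / 1000 * α ^ 3 := by
  have hα := hX.isStandardized.pos
  have hM := hX.three_sixteenths_le
  have hn : (1 : ℝ) ≤ n₀ := by exact_mod_cast hX.one_le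
  have hM2 : 1 ≤ 29 * M ^ 2 := by nlinarith
  have hMp : 0 < M := by linarith
  rw [le_div_iff₀ (by positivity)] at hh
  have : 0 ≤ |h| * n₀ := by positivity
  nlinarith

lemma abs_le_of_le {h : ℝ} (hh : |h| ≤ α ^ 3 / (1000 * M ^ 2 * n₀)) :
    |h| ≤ 29 / 1000 * α ^ 3 := by
  have hn : (1 : ℝ) ≤ n₀ := by exact_mod_cast hX.one_le
  have := hX.abs_mul_le hh
  nlinarith [abs_nonneg h]

lemma abs_mul_sqrt_le {h : ℝ} (hh : |h| ≤ α ^ 3 / (1000 * M ^ 2 * n₀)) :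
    |h * √(n₀ : ℝ)| ≤ 1 / 4 := by
  have hn : (1 : ℝ) ≤ n₀ := by exact_mod_cast hX.one_le
  have h1 := hX.abs_mul_le hh
  have h2 := hX.isStandardized.cube_le
  have h3 : √(n₀ : ℝ) ≤ n₀ := Real.sqrt_le_iff.2 ⟨by linarith, by nlinarith⟩
  rw [abs_mul, abs_of_nonneg (Real.sqrt_nonneg _)]
  nlinarith [abs_nonneg h]

lemma mgf_pow_le_two {h : ℝ} (hh : |h| ≤ α ^ 3 / (1000 * M ^ 2 * n₀)) {b : ℝ}
    (hb : b = h ∨ b = 2 * h) : mgf (X 0) P b ^ n₀ ≤ 2 := by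
  have hα := hX.isStandardized.pos
  have hn : (1 : ℝ) ≤ n₀ := by exact_mod_cast hX.one_le
  have h1 := hX.abs_mul_le hh
  have h0 := hX.abs_le_of_le hh
  have h2 := hX.isStandardized.sq_le_two
  have h3 : α ^ 3 ≤ 2 * α := by nlinarith
  have hb' : |b| ≤ 2 * |h| := by
    rcases hb with rfl | rfl
    · linarith [abs_nonneg b]
    · rw [abs_mul, abs_two]
  refine hX.isStandardized.mgf_pow_le_two (by linarith) ?_
  have h4 : |b| * n₀ ≤ 116 / 1000 * α := by nlinarith
  have h5 : (|b| * n₀) * (|b| * n₀) ≤ (116 / 1000 * α) * (116 / 1000 * α) := by gcongr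
  calc n₀ * (4 * b ^ 2) = 4 * (|b| * (|b| * n₀)) := by rw [← sq_abs b]; ring
    _ ≤ 4 * ((|b| * n₀) * (|b| * n₀)) := by
        gcongr
        exact le_mul_of_one_le_right (abs_nonneg b) hn
    _ ≤ α ^ 2 := by nlinarith

lemma mgf_pos {h : ℝ} (hh : |h| ≤ α ^ 3 / (1000 * M ^ 2 * n₀)) : 0 < mgf (X 0) P h := by
  have h1 := hX.abs_le_of_le hh
  have h2 := hX.isStandardized.cube_div_le
  have hα := hX.isStandardized.pos
  exact one_pos.trans_le (hX.isStandardized.one_le_mgf (by linarith))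

lemma integrable_exp_normalizedSum {b : ℝ} {n : ℕ} (hb : |b / √(n : ℝ)| ≤ α) :
    Integrable (fun x => Real.exp (b * x)) (P.map (normalizedSum X n)) := by
  refine integrable_of_mgf_ne_zero ?_
  rw [mgf_normalizedSum hX.iIndepFun hX.identDistrib]
  exact (pow_pos (one_pos.trans_le (hX.isStandardized.one_le_mgf hb)) n).ne'

/-- Away from the origin, the tilted characteristic function stays uniformly below `1`. -/
lemma norm_tiltedCharFun_pow_le {h s δ : ℝ} (hh : |h| ≤ α ^ 3 / (1000 * M ^ 2 * n₀))
    (hδ : 0 ≤ δ) (hδ1 : δ ≤ 1) (hs : δ ≤ |s|) :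
    ‖tiltedCharFun (X 0) P h s‖ ^ n₀ ≤ Real.exp (-(δ ^ 2 / (12000 * M ^ 2))) := by
  have hM := hX.three_sixteenths_le
  have hMp : 0 < M := by linarith
  have hα := hX.isStandardized.pos
  have hn : (1 : ℝ) ≤ n₀ := by exact_mod_cast hX.one_le
  have hr := hX.sqrt_pos
  have hr1 : 1 ≤ √(n₀ : ℝ) := Real.one_le_sqrt.2 hn
  obtain ⟨q, hq, hqM⟩ := hX.exists_density
  have := hX.isProbabilityMeasure_map n₀
  obtain ⟨hi, h2⟩ := integral_sq_normalizedSum hX.isStandardized hX.iIndepFun hX.identDistrib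
    hX.one_le
  have hb := hX.abs_mul_sqrt_le hh
  have h1 := hX.abs_le_of_le hh
  have h8 := hX.isStandardized.cube_div_le
  have hkey := norm_complexMGF_le_of_density hq hqM hi h2.le (h := h * √(n₀ : ℝ))
    (t := s * √(n₀ : ℝ)) (by linarith) (hX.integrable_exp_normalizedSum (by
      rw [mul_div_cancel_right₀ _ hr.ne']; linarith))
  rw [hX.complexMGF_normalizedSum_line hX.one_le, hX.mgf_normalizedSum_line hX.one_le,
    mul_div_cancel_right₀ _ hr.ne', norm_pow] at hkey
  have hmin : δ ≤ min 1 |s * √(n₀ : ℝ)| := by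
    refine le_min hδ1 ?_
    rw [abs_mul, abs_of_pos hr]
    nlinarith
  have hm0 : 0 < mgf (X 0) P h ^ n₀ := pow_pos (hX.mgf_pos hh) _
  have hm2 := hX.mgf_pow_le_two hh (.inl rfl)
  rw [norm_tiltedCharFun, div_pow, div_le_iff₀ hm0]
  have h3 : δ ^ 2 / (6000 * M ^ 2) ≤ min 1 |s * √(n₀ : ℝ)| ^ 2 / (6000 * M ^ 2) := by gcongr
  have h4 := Real.add_one_le_exp (-(δ ^ 2 / (12000 * M ^ 2)))
  have h5 : δ ^ 2 / (6000 * M ^ 2) = 2 * (δ ^ 2 / (12000 * M ^ 2)) := by ring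
  have h6 : 0 ≤ δ ^ 2 / (12000 * M ^ 2) := by positivity
  nlinarith

/-- Plancherel's theorem for the tilted law of the normalized sum with bounded density. -/
lemma integral_norm_tiltedCharFun_pow_le {h : ℝ} (hh : |h| ≤ α ^ 3 / (1000 * M ^ 2 * n₀)) :
    Integrable (fun s => ‖tiltedCharFun (X 0) P h s‖ ^ (2 * n₀)) ∧
      ∫ s, ‖tiltedCharFun (X 0) P h s‖ ^ (2 * n₀) ≤ 4 * Real.pi * M := by
  have hM := hX.three_sixteenths_le
  have hMp : 0 < M := by linarith
  have hα := hX.isStandardized.pos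
  have hn : (1 : ℝ) ≤ n₀ := by exact_mod_cast hX.one_le
  have hr := hX.sqrt_pos
  have hr1 : 1 ≤ √(n₀ : ℝ) := Real.one_le_sqrt.2 hn
  obtain ⟨q, hq, hqM⟩ := hX.exists_density
  have h1 := hX.abs_le_of_le hh
  have h8 := hX.isStandardized.cube_div_le
  have he : ∀ b : ℝ, |b| ≤ 2 * |h| →
      Integrable (fun x => Real.exp (b * √(n₀ : ℝ) * x)) (P.map (normalizedSum X n₀)) :=
    fun b hb => hX.integrable_exp_normalizedSum (by
      rw [mul_div_cancel_right₀ _ hr.ne']; linarith)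
  obtain ⟨hi, hI⟩ := integral_complexMGF_sq_le hq hqM (h := h * √(n₀ : ℝ))
    (he h (by linarith [abs_nonneg h])) (by
      have := he (2 * h) (by rw [abs_mul, abs_two])
      simpa only [mul_assoc] using this)
  rw [← mul_assoc, hX.mgf_normalizedSum_line hX.one_le] at hI
  simp only [hX.complexMGF_normalizedSum_line hX.one_le, norm_pow, ← pow_mul,
    mul_comm n₀ 2] at hi hI
  set G : ℝ → ℝ := fun s => ‖complexMGF (X 0) P (h + s * I)‖ ^ (2 * n₀) with hG
  have hi' : Integrable fun t => G (t / √(n₀ : ℝ)) := hi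
  have hI' : ∫ t, G (t / √(n₀ : ℝ)) ≤ 2 * Real.pi * M * mgf (X 0) P (2 * h) ^ n₀ := hI
  have hGi : Integrable G := (integrable_comp_div_iff G hr.ne').1 hi'
  rw [Measure.integral_comp_div G, smul_eq_mul, abs_of_pos hr] at hI'
  have hm1 : 1 ≤ mgf (X 0) P h := hX.isStandardized.one_le_mgf (by linarith)
  have hle : ∀ s, ‖tiltedCharFun (X 0) P h s‖ ^ (2 * n₀) ≤ G s := fun s => by
    rw [norm_tiltedCharFun]
    exact pow_le_pow_left₀ (div_nonneg (norm_nonneg _) mgf_nonneg)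
      (div_le_self (norm_nonneg _) hm1) _
  have hti : Integrable (fun s => ‖tiltedCharFun (X 0) P h s‖ ^ (2 * n₀)) := by
    have : (fun s => ‖tiltedCharFun (X 0) P h s‖ ^ (2 * n₀))
        = fun s => G s / mgf (X 0) P h ^ (2 * n₀) := by
      ext s; rw [norm_tiltedCharFun, div_pow]
    rw [this]; exact hGi.div_const _
  refine ⟨hti, (integral_mono hti hGi hle).trans ?_⟩
  have hG0 : 0 ≤ ∫ s, G s := integral_nonneg fun s => by positivity
  have hm2 := hX.mgf_pow_le_two hh (.inr rfl)
  calc ∫ s, G s ≤ √(n₀ : ℝ) * ∫ s, G s := le_mul_of_one_le_left hG0 hr1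
    _ ≤ 2 * Real.pi * M * mgf (X 0) P (2 * h) ^ n₀ := hI'
    _ ≤ 2 * Real.pi * M * 2 := by gcongr
    _ = _ := by ring

lemma continuous_tiltedCharFun {h : ℝ} (hh : |h| ≤ α ^ 3 / (1000 * M ^ 2 * n₀)) :
    Continuous fun s => tiltedCharFun (X 0) P h s := by
  have h1 := hX.abs_le_of_le hh
  have h8 := hX.isStandardized.cube_div_le
  have hα := hX.isStandardized.pos
  exact (hX.isStandardized.continuous_complexMGF (by linarith)).div_const _

lemma integrable_tiltedCharFun_pow {h : ℝ} (hh : |h| ≤ α ^ 3 / (1000 * M ^ 2 * n₀)) {n : ℕ}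
    (hn : 2 * n₀ ≤ n) : Integrable (fun t => tiltedCharFun (X 0) P h (t / √(n : ℝ)) ^ n) := by
  have hc := hX.continuous_tiltedCharFun hh
  have hn0 : 0 < n := by have := hX.one_le; omega
  have hr : √(n : ℝ) ≠ 0 := (Real.sqrt_pos.2 (by exact_mod_cast hn0)).ne'
  have hi := (hX.integral_norm_tiltedCharFun_pow_le hh).1
  refine ((integrable_comp_div_iff _ hr).2 hi).mono'
    (by fun_prop) (.of_forall fun t => ?_)
  rw [norm_pow]
  exact pow_le_pow_of_le_one (norm_nonneg _) (norm_tiltedCharFun_le_one _ _ _ _) hn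

/-- The contribution of the large frequencies is exponentially small in `n`. -/
lemma setIntegral_tiltedCharFun_pow_le {h δ : ℝ} (hh : |h| ≤ α ^ 3 / (1000 * M ^ 2 * n₀))
    (hδ : 0 ≤ δ) (hδ1 : δ ≤ 1) {n : ℕ} (hn : 4 * n₀ ≤ n) :
    ∫ t in {t : ℝ | δ * √(n : ℝ) < |t|}, ‖tiltedCharFun (X 0) P h (t / √(n : ℝ))‖ ^ n ≤
      Real.exp (-(δ ^ 2 / (24000 * M ^ 2 * n₀) * n)) * (√(n : ℝ) * (4 * Real.pi * M)) := by
  have hM := hX.three_sixteenths_le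
  have hMp : 0 < M := by linarith
  have hc := hX.continuous_tiltedCharFun hh
  have h1 := hX.one_le
  have hn0 : 0 < n := by omega
  have hr : 0 < √(n : ℝ) := Real.sqrt_pos.2 (by exact_mod_cast hn0)
  obtain ⟨hi, hI⟩ := hX.integral_norm_tiltedCharFun_pow_le hh
  have hi' := (integrable_comp_div_iff _ hr.ne').2 hi
  have hn0' : (0 : ℝ) < n₀ := by exact_mod_cast h1
  have hms : MeasurableSet {t : ℝ | δ * √(n : ℝ) < |t|} :=
    measurableSet_lt measurable_const (by fun_prop)
  have hle : ∀ t ∈ {t : ℝ | δ * √(n : ℝ) < |t|}, ‖tiltedCharFun (X 0) P h (t / √(n : ℝ))‖ ^ n ≤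
      Real.exp (-(δ ^ 2 / (24000 * M ^ 2 * n₀) * n)) *
        ‖tiltedCharFun (X 0) P h (t / √(n : ℝ))‖ ^ (2 * n₀) := by
    intro t ht
    rw [Set.mem_ofPred_eq] at ht
    have hs : δ ≤ |t / √(n : ℝ)| := by
      rw [abs_div, abs_of_pos hr, le_div_iff₀ hr]; exact ht.le
    have h2 := hX.norm_tiltedCharFun_pow_le hh hδ hδ1 hs
    set φ := ‖tiltedCharFun (X 0) P h (t / √(n : ℝ))‖
    have hφ0 : 0 ≤ φ := norm_nonneg _
    have h3 : φ ≤ Real.exp (-(δ ^ 2 / (12000 * M ^ 2 * n₀))) := by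
      rw [← pow_le_pow_iff_left₀ hφ0 (Real.exp_pos _).le (by omega : n₀ ≠ 0),
        ← Real.exp_nat_mul]
      refine h2.trans_eq ?_
      congr 1; field_simp
    obtain ⟨k, rfl⟩ : ∃ k, n = k + 2 * n₀ := ⟨n - 2 * n₀, by omega⟩
    rw [pow_add]
    refine mul_le_mul_of_nonneg_right ?_ (by positivity)
    calc φ ^ k ≤ Real.exp (-(δ ^ 2 / (12000 * M ^ 2 * n₀))) ^ k := by gcongr
      _ = Real.exp (-(δ ^ 2 / (24000 * M ^ 2 * n₀) * (2 * k))) := by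
          rw [← Real.exp_nat_mul]; congr 1; ring
      _ ≤ _ := by
          gcongr
          have : (k + 2 * n₀ : ℕ) ≤ 2 * k := by omega
          exact_mod_cast this
  calc _ ≤ ∫ t in {t : ℝ | δ * √(n : ℝ) < |t|}, Real.exp (-(δ ^ 2 / (24000 * M ^ 2 * n₀) * n)) *
        ‖tiltedCharFun (X 0) P h (t / √(n : ℝ))‖ ^ (2 * n₀) := by
        refine setIntegral_mono_on ?_ (hi'.const_mul _).integrableOn hms hle
        have := (hX.integrable_tiltedCharFun_pow hh (n := n) (by omega)).norm
        simp only [norm_pow] at this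
        exact this.integrableOn
    _ ≤ ∫ t, Real.exp (-(δ ^ 2 / (24000 * M ^ 2 * n₀) * n)) *
        ‖tiltedCharFun (X 0) P h (t / √(n : ℝ))‖ ^ (2 * n₀) :=
        setIntegral_le_integral (hi'.const_mul _) (.of_forall fun t => by positivity)
    _ ≤ _ := by
        rw [integral_const_mul,
          Measure.integral_comp_div fun s => ‖tiltedCharFun (X 0) P h s‖ ^ (2 * n₀), smul_eq_mul,
          abs_of_pos hr]
        gcongr

end IsIIDWithDensity

end

/-! ### The inversion integral through the saddle point -/

section

variable {Ω : Type*} [MeasurableSpace Ω]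

open Complex Metric Topology

lemma pow_three_mul_exp_neg_le {y : ℝ} (hy : 0 < y) : y ^ 3 * Real.exp (-y) ≤ 120 / y ^ 2 := by
  have h1 := Real.pow_div_factorial_le_exp y hy.le 5
  rw [show ((Nat.factorial 5 : ℕ) : ℝ) = 120 by norm_num [Nat.factorial],
    div_le_iff₀ (by norm_num)] at h1
  rw [le_div_iff₀ (by positivity), Real.exp_neg, mul_right_comm, ← div_eq_mul_inv,
    div_le_iff₀ (Real.exp_pos _)]
  nlinarith

namespace IsIIDWithDensity

variable {X : ℕ → Ω → ℝ} {P : Measure Ω} [IsProbabilityMeasure P] {α M : ℝ} {n₀ : ℕ}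
  (hX : IsIIDWithDensity X P α M n₀)
include hX

/-- The consequences of `n` being large; the last one makes the contribution of the frequencies
beyond `α³/1024` of order `M √n e^{-√n}`, and it forces the numerical constant to be at least
`(24000 · 1024²)²`. -/
lemma size_bounds {n : ℕ} (hn : 10 ^ 22 * M ^ 4 * (n₀ : ℝ) ^ 2 / α ^ 12 ≤ n) :
    4 * n₀ ≤ n ∧ M ≤ n ∧ √(n : ℝ) ≤ (α ^ 3 / 1024) ^ 2 / (24000 * M ^ 2 * n₀) * n := by
  have hM := hX.three_sixteenths_le
  have hMp : 0 < M := by linarith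
  have hα := hX.isStandardized.pos
  have hα2 := hX.isStandardized.sq_le_two
  have h0 : (1 : ℝ) ≤ n₀ := by exact_mod_cast hX.one_le
  have hα6 : α ^ 6 ≤ 8 := by
    calc α ^ 6 = (α ^ 2) ^ 3 := by ring
      _ ≤ 2 ^ 3 := by gcongr
      _ = 8 := by norm_num
  obtain ⟨a, ha⟩ : ∃ a, a = M ^ 2 * n₀ / α ^ 6 := ⟨_, rfl⟩
  have hα6p : 0 < α ^ 6 := by positivity
  have ha1 : M ^ 2 * n₀ = a * α ^ 6 := by rw [ha]; field_simp
  have ha0 : 0 < a := by rw [ha]; positivity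
  have hn' : 10 ^ 22 * a ^ 2 ≤ n := by
    refine le_trans (le_of_eq ?_) hn
    rw [ha]; field_simp
  have ha2 : M ^ 2 * n₀ ≤ 8 * a := by rw [ha1]; nlinarith
  have hM2 : 9 / 256 ≤ M ^ 2 := by nlinarith
  have ha3 : n₀ ≤ 1000 * a := by nlinarith
  have hM3 : M ^ 2 ≤ M ^ 2 * n₀ := le_mul_of_one_le_right (by positivity) h0
  have ha4 : M ≤ 1000 * a := by nlinarith
  have ha5 : 1 ≤ 1000 * a := h0.trans ha3
  have ha6 : 4000 * a ≤ n := by nlinarith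
  refine ⟨?_, by linarith, ?_⟩
  · have : (4 * n₀ : ℝ) ≤ n := by linarith
    exact_mod_cast this
  · have h1 : 24000 * 1024 ^ 2 * a ≤ √(n : ℝ) := by
      refine Real.le_sqrt_of_sq_le ?_
      nlinarith [sq_nonneg a]
    have h2 : (α ^ 3 / 1024) ^ 2 / (24000 * M ^ 2 * n₀) = 1 / (24000 * 1024 ^ 2 * a) := by
      rw [mul_assoc, ha1]; field_simp
    rw [h2, one_div_mul_eq_div, le_div_iff₀ (by positivity)]
    calc √(n : ℝ) * (24000 * 1024 ^ 2 * a) ≤ √(n : ℝ) * √(n : ℝ) := by gcongr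
      _ = n := Real.mul_self_sqrt (Nat.cast_nonneg n)

lemma exists_continuous_density {n : ℕ} (hn : 4 * n₀ ≤ n) :
    ∃ p : ℝ → ℝ, IsDensity (P.map (normalizedSum X n)) p ∧ Continuous p ∧
      ∃ D : ℝ, ∀ x, p x ≤ D := by
  have h1 := hX.one_le
  have hα := hX.isStandardized.pos
  have := hX.isProbabilityMeasure_map n
  obtain ⟨q, hq, -⟩ := hX.exists_density
  have hac := map_normalizedSum_absolutelyContinuous hX.iIndepFun hX.aemeasurable h1
    (by omega : n₀ ≤ n) hq.absolutelyContinuous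
  have hint : Integrable (charFun (P.map (normalizedSum X n))) := by
    have h2 := hX.integrable_tiltedCharFun_pow (h := 0) (by rw [abs_zero]; positivity) (n := n)
      (by omega)
    refine h2.congr (.of_forall fun t => ?_)
    have h3 := hX.complexMGF_normalizedSum_line (n := n) (by omega) 0 t
    rw [zero_mul, ofReal_zero, zero_add, complexMGF_id_mul_I] at h3
    simp only [tiltedCharFun, mgf_zero, ofReal_zero, ofReal_one, div_one]
    exact h3.symm
  obtain ⟨p, hp, hpc, hD, -⟩ := exists_density_of_integrable_charFun hac hint
  exact ⟨p, hp, hpc, hD⟩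

/-- The inversion integral along the vertical line through `h`. -/
lemma density_eq {n : ℕ} (hn : 4 * n₀ ≤ n) {p : ℝ → ℝ}
    (hp : IsDensity (P.map (normalizedSum X n)) p) (hpc : Continuous p) {h : ℝ}
    (hh : |h| ≤ α ^ 3 / (1000 * M ^ 2 * n₀)) (x : ℝ) :
    (p x : ℂ) = ((Real.exp (-(h * √(n : ℝ) * x)) * mgf (X 0) P h ^ n / (2 * Real.pi) : ℝ) : ℂ) *
      ∫ t : ℝ, tiltedCharFun (X 0) P h (t / √(n : ℝ)) ^ n * cexp (-(t * x * I)) := by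
  have h1 := hX.one_le
  have hn0 : 0 < n := by omega
  have := hX.isProbabilityMeasure_map n
  have hm := hX.mgf_pos hh
  have hm' : (mgf (X 0) P h : ℂ) ≠ 0 := by exact_mod_cast hm.ne'
  have hE : ∀ t : ℝ, complexMGF id (P.map (normalizedSum X n)) ((h * √(n : ℝ) : ℝ) + t * I) =
      (mgf (X 0) P h : ℂ) ^ n * tiltedCharFun (X 0) P h (t / √(n : ℝ)) ^ n := fun t => by
    rw [hX.complexMGF_normalizedSum_line hn0, tiltedCharFun, div_pow,
      mul_div_cancel₀ _ (pow_ne_zero n hm')]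
  have hH : Integrable (fun x => Real.exp (h * √(n : ℝ) * x)) (P.map (normalizedSum X n)) := by
    refine integrable_of_mgf_ne_zero ?_
    rw [hX.mgf_normalizedSum_line hn0]
    positivity
  rw [hp.eq_integral_complexMGF hpc hH (by
    simp only [hE]
    exact (hX.integrable_tiltedCharFun_pow hh (by omega)).const_mul _)]
  simp only [hE]
  have : ∀ t : ℝ, cexp (-(t * x * I)) * ((mgf (X 0) P h : ℂ) ^ n *
      tiltedCharFun (X 0) P h (t / √(n : ℝ)) ^ n) = (mgf (X 0) P h : ℂ) ^ n *
      (tiltedCharFun (X 0) P h (t / √(n : ℝ)) ^ n * cexp (-(t * x * I))) := fun t => by ring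
  simp only [this, integral_const_mul]
  push_cast
  ring

/-- The inversion integral through the saddle point is almost a Gaussian integral. -/
lemma norm_integral_tiltedCharFun_sub_le {n : ℕ}
    (hn : 10 ^ 22 * M ^ 4 * (n₀ : ℝ) ^ 2 / α ^ 12 ≤ n) {h τ v : ℝ}
    (hh : |h| ≤ α ^ 3 / (1000 * M ^ 2 * n₀))
    (hτ : deriv (logLaplace (X 0) P) h = τ) (hv : deriv (deriv (logLaplace (X 0) P)) h = v)
    (hv2 : 1 / 2 ≤ v) :
    ‖(∫ t : ℝ, tiltedCharFun (X 0) P h (t / √(n : ℝ)) ^ n *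
        cexp (-(t * (√(n : ℝ) * τ : ℝ) * I))) - ((√(2 * Real.pi / v) : ℝ) : ℂ)‖ ≤
      (2 ^ 20 * gaussMoment + 12096) / (α ^ 6 * n) := by
  have hS := hX.isStandardized
  have hα := hS.pos
  have hα3 := hS.cube_le
  have h8 := hS.cube_div_le
  have hα2 := hS.sq_le_two
  have h1 := hX.abs_le_of_le hh
  have hM := hX.three_sixteenths_le
  have hMp : 0 < M := by linarith
  have hn1 := hX.one_le
  obtain ⟨hn4, hMn, hsq⟩ := hX.size_bounds hn
  have hn0 : (0 : ℝ) < n := by exact_mod_cast (by omega : 0 < n)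
  set N := √(n : ℝ) with hN
  have hNp : 0 < N := Real.sqrt_pos.2 hn0
  have hN2 : N ^ 2 = n := Real.sq_sqrt hn0.le
  have hnorm : ∀ t : ℝ, ‖tiltedCharFun (X 0) P h (t / N) ^ n * cexp (-(t * (N * τ : ℝ) * I))‖ =
      ‖tiltedCharFun (X 0) P h (t / N)‖ ^ n := fun t => by
    rw [norm_mul, norm_pow, show -((t : ℂ) * (N * τ : ℝ) * I) = ((-(t * (N * τ)) : ℝ) : ℂ) * I by
      push_cast; ring, norm_exp_ofReal_mul_I, mul_one]
  have hF : Integrable fun t : ℝ =>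
      tiltedCharFun (X 0) P h (t / N) ^ n * cexp (-(t * (N * τ : ℝ) * I)) := by
    have h2 := hX.integrable_tiltedCharFun_pow hh (by omega : 2 * n₀ ≤ n)
    refine h2.norm.mono' (h2.aestronglyMeasurable.mul (by fun_prop)) (.of_forall fun t => ?_)
    rw [hnorm, norm_pow]
  obtain ⟨a, ha, hexp⟩ := hS.exists_norm_exp_sub_le (by linarith [pow_pos hα 3]) hτ hv hv2 hNp
  refine (norm_integral_sub_gaussian_le hF hα hv2 hNp ha fun t ht => ?_).trans ?_
  · convert! hexp t ht using 2
    congr 1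
    have hs : |t / N| ≤ α ^ 3 / 1024 := by
      rw [abs_div, abs_of_pos hNp, div_le_iff₀ hNp]; exact ht
    have hz : ‖(h : ℂ) + (t / N : ℝ) * I‖ ≤ α / 2 := by
      refine (norm_add_le _ _).trans ?_
      rw [norm_mul, norm_I, mul_one, norm_real, norm_real, Real.norm_eq_abs, Real.norm_eq_abs]
      linarith
    have hz0 : ‖(h : ℂ)‖ ≤ α / 2 := by
      rw [norm_real, Real.norm_eq_abs]; linarith
    rw [tiltedCharFun, ← complexMGF_ofReal, ← hS.exp_logLaplace hz, ← hS.exp_logLaplace hz0,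
      ← Complex.exp_sub, ← Complex.exp_nat_mul, ← Complex.exp_add]
    congr 1
    have hN2' : (N : ℂ) ^ 2 = n := by exact_mod_cast hN2
    rw [hN2']
    have : (t : ℂ) * (N * τ : ℝ) * I = n * ((t / N : ℝ) * I * τ) := by
      rw [← hN2']
      have : (N : ℂ) ≠ 0 := by exact_mod_cast hNp.ne'
      push_cast
      field_simp
    rw [this]; ring
  · simp only [hnorm]
    rw [hN2, add_div]
    gcongr
    have ht := hX.setIntegral_tiltedCharFun_pow_le hh (δ := α ^ 3 / 1024) (by positivity)
      (by linarith) hn4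
    refine ht.trans ?_
    have hα6 : α ^ 6 ≤ 8 := by
      calc α ^ 6 = (α ^ 2) ^ 3 := by ring
        _ ≤ 2 ^ 3 := by gcongr
        _ = 8 := by norm_num
    calc _ ≤ Real.exp (-N) * (N * (4 * Real.pi * n)) := by gcongr
      _ = 4 * Real.pi * (N ^ 3 * Real.exp (-N)) := by rw [← hN2]; ring
      _ ≤ 4 * Real.pi * (120 / N ^ 2) := by
          gcongr; exact pow_three_mul_exp_neg_le hNp
      _ ≤ 4 * 3.15 * (120 / N ^ 2) := by
          gcongr; exact Real.pi_lt_d2.le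
      _ ≤ 12096 / (α ^ 6 * n) := by
          rw [hN2, ← mul_div_assoc, div_le_div_iff₀ hn0 (by positivity)]
          nlinarith

end IsIIDWithDensity

end

/-! ### The density relative to the Gaussian -/

section

variable {Ω : Type*} [MeasurableSpace Ω]

open Complex Metric Topology

namespace IsStandardized

lemma of_variance_eq_one {X : Ω → ℝ} {P : Measure Ω} {α : ℝ}
    (hm : AEMeasurable X P) (h0 : ∫ ω, X ω ∂P = 0) (h1 : Var[X; P] = 1) (hα : 0 < α)
    (hi : Integrable (fun ω => Real.exp (α * |X ω|)) P)
    (h2 : ∫ ω, Real.exp (α * |X ω|) ∂P ≤ 2) : IsStandardized X P α where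
  aemeasurable := hm
  integral_eq := h0
  integral_sq := by rw [← variance_of_integral_eq_zero hm h0, h1]
  pos := hα
  integrable_exp := hi
  integral_exp_le := h2

/-- The exponential factor of the expansion, written out at a real saddle point. -/
lemma exp_cramer_sub_muFun {X : Ω → ℝ} {P : Measure Ω} [IsProbabilityMeasure P] {α : ℝ}
    (hX : IsStandardized X P α) {τ h v : ℝ} (hτ : saddlePoint X P α τ = h) (hh : |h| ≤ α / 2)
    (hv : deriv (deriv (logLaplace X P)) h = v) (hv0 : 0 < v) (n : ℕ) :
    cexp (n * (τ : ℂ) ^ 3 * cramer X P α τ - muFun X P α τ) =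
      ((mgf X P h ^ n * Real.exp (-(n * (τ * h))) * Real.exp (n * τ ^ 2 / 2) / √v : ℝ) : ℂ) := by
  have hK := hX.exp_logLaplace (z := h) (by rwa [norm_real])
  rw [complexMGF_ofReal] at hK
  have hμ : cexp (-muFun X P α τ) = ((√v)⁻¹ : ℝ) := by
    rw [muFun_eq, hτ, hv, ← ofReal_log hv0.le]
    have : -((Real.log v : ℂ) / 2) = ((-(Real.log v / 2) : ℝ) : ℂ) := by push_cast; ring
    rw [this, ← ofReal_exp, Real.exp_neg, Real.exp_half, Real.exp_log hv0]
  have h3 : (n : ℂ) * (τ : ℂ) ^ 3 * cramer X P α τ - muFun X P α τ =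
      n * logLaplace X P h + ((-(n * (τ * h)) : ℝ) : ℂ) + ((n * τ ^ 2 / 2 : ℝ) : ℂ)
        + -muFun X P α τ := by
    rw [mul_assoc, hX.pow_mul_cramer, saddleValue, hτ]
    push_cast
    ring
  rw [h3, Complex.exp_add, Complex.exp_add, Complex.exp_add, Complex.exp_nat_mul, hK, hμ,
    ← ofReal_exp, ← ofReal_exp]
  push_cast
  ring

end IsStandardized

lemma gaussianPDFReal_zero_one (x : ℝ) :
    gaussianPDFReal 0 1 x = (√(2 * Real.pi))⁻¹ * Real.exp (-(x ^ 2 / 2)) := by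
  simp [gaussianPDFReal, neg_div]

namespace IsIIDWithDensity

variable {X : ℕ → Ω → ℝ} {P : Measure Ω} [IsProbabilityMeasure P] {α M : ℝ} {n₀ : ℕ}
  (hX : IsIIDWithDensity X P α M n₀)
include hX

lemma radius_lt : 1 / 2000 * α ^ 3 / (M ^ 2 * n₀) < α ^ 3 / 32 := by
  have hM := hX.three_sixteenths_le
  have hα := pow_pos hX.isStandardized.pos 3
  have hn : (1 : ℝ) ≤ n₀ := by exact_mod_cast hX.one_le
  have hM2 : 9 / 256 ≤ M ^ 2 := by nlinarith
  have h1 : 9 / 256 ≤ M ^ 2 * n₀ := by nlinarith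
  rw [div_lt_div_iff₀ (by linarith) (by norm_num)]
  nlinarith

/-- The relative form of the local limit theorem at a real point. -/
lemma exists_div_gaussian_eq {n : ℕ} (hn : 10 ^ 22 * M ^ 4 * (n₀ : ℝ) ^ 2 / α ^ 12 ≤ n)
    {p : ℝ → ℝ} (hp : IsDensity (P.map (normalizedSum X n)) p) (hpc : Continuous p) {τ : ℝ}
    (hτ : |τ| ≤ 1 / 2000 * α ^ 3 / (M ^ 2 * n₀)) :
    ∃ ρ : ℝ, |ρ - 1| ≤ (2 ^ 20 * gaussMoment + 12096) / (α ^ 6 * n) ∧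
      ((p (√(n : ℝ) * τ) / gaussianPDFReal 0 1 (√(n : ℝ) * τ) : ℝ) : ℂ) =
        cexp (n * (τ : ℂ) ^ 3 * cramer (X 0) P α τ - muFun (X 0) P α τ) * ρ := by
  have hS := hX.isStandardized
  have hα := hS.pos
  have hr := hX.radius_lt
  have hn4 := (hX.size_bounds hn).1
  obtain ⟨h, hh, hhτ⟩ := hS.exists_real_saddlePoint (τ := τ) (by linarith)
  have hsp := hS.isSaddlePoint_saddlePoint (τ := τ) (by
    rw [norm_real, Real.norm_eq_abs]; linarith)
  rw [hh] at hsp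
  have hh' : |h| ≤ α ^ 3 / (1000 * M ^ 2 * n₀) := by
    refine hhτ.trans ((mul_le_mul_of_nonneg_left hτ zero_le_two).trans_eq ?_)
    rw [mul_assoc 1000, ← div_div]; ring
  have h16 : |h| ≤ α ^ 3 / 16 := by linarith [hX.abs_le_of_le hh', pow_pos hα 3]
  obtain ⟨v, hv, hv1, hv2⟩ := hS.exists_real_deriv_deriv_logLaplace h16
  have hest := hX.norm_integral_tiltedCharFun_sub_le hn hh' hsp.2 hv hv1
  have hden := hX.density_eq hn4 hp hpc hh' (√(n : ℝ) * τ)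
  have hexp := hS.exp_cramer_sub_muFun hh (by linarith [hS.cube_div_le]) hv (by linarith) n
  have hm := pow_pos (hX.mgf_pos hh') n
  have hN2 : √(n : ℝ) ^ 2 = n := Real.sq_sqrt (Nat.cast_nonneg n)
  generalize (∫ t : ℝ, tiltedCharFun (X 0) P h (t / √(n : ℝ)) ^ n *
    cexp (-(t * (√(n : ℝ) * τ : ℝ) * I))) = J at hest hden
  set A := mgf (X 0) P h ^ n
  rw [show h * √(n : ℝ) * (√(n : ℝ) * τ) = n * (τ * h) by
    linear_combination h * τ * hN2] at hden
  set E := Real.exp (-(n * (τ * h)))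
  have hE : 0 < E := Real.exp_pos _
  -- the inversion integral is real because the density is
  obtain ⟨j, rfl⟩ : ∃ j : ℝ, J = j := by
    refine ⟨p (√(n : ℝ) * τ) / (E * A / (2 * Real.pi)), ?_⟩
    rw [ofReal_div, hden, mul_div_cancel_left₀]
    exact_mod_cast (by positivity : E * A / (2 * Real.pi) ≠ 0)
  rw [← ofReal_sub, norm_real, Real.norm_eq_abs] at hest
  have hden' : p (√(n : ℝ) * τ) = E * A / (2 * Real.pi) * j := by exact_mod_cast hden
  have hsv : 0 < √v := Real.sqrt_pos.2 (by linarith)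
  have hsp2 : 0 < √(2 * Real.pi) := Real.sqrt_pos.2 (by positivity)
  refine ⟨√v / √(2 * Real.pi) * j, ?_, ?_⟩
  · refine le_trans ?_ hest
    have h1 : √v / √(2 * Real.pi) * j - 1 =
        √v / √(2 * Real.pi) * (j - √(2 * Real.pi / v)) := by
      rw [Real.sqrt_div (by positivity)]; field_simp
    rw [h1, abs_mul, abs_of_pos (by positivity)]
    refine mul_le_of_le_one_left (abs_nonneg _) ?_
    rw [div_le_one hsp2]
    exact Real.sqrt_le_sqrt (by linarith [Real.pi_gt_three])
  · rw [hexp, ← ofReal_mul]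
    congr 1
    rw [hden', gaussianPDFReal_zero_one, mul_pow, hN2, Real.exp_neg]
    have h2 : √(2 * Real.pi) ^ 2 = 2 * Real.pi := Real.sq_sqrt (by positivity)
    have := Real.exp_pos (n * τ ^ 2 / 2)
    generalize √(2 * Real.pi) = s at h2 hsp2 ⊢
    rw [← h2]
    field_simp

end IsIIDWithDensity

end

end LocalLimit

theorem theorem1p4 :
    ∃ C c : ℝ, 0 < C ∧ 0 < c ∧
      ∀ {Ω : Type*} [MeasurableSpace Ω] (P : Measure Ω) [IsProbabilityMeasure P]
        (X : ℕ → Ω → ℝ) (α M : ℝ) (n₀ : ℕ),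
        -- independent copies of a random variable, with mean zero and variance one
        iIndepFun X P →
        (∀ i, IdentDistrib (X i) (X 0) P P) →
        (∫ ω, X 0 ω ∂P) = 0 →
        variance (X 0) P = 1 →
        -- the exponential moment
        0 < α →
        Integrable (fun ω => Real.exp (α * |X 0 ω|)) P →
        (∫ ω, Real.exp (α * |X 0 ω|) ∂P) ≤ 2 →
        -- a normalized sum with a density bounded by `M`
        1 ≤ n₀ →
        (∃ q : ℝ → ℝ, LocalLimit.IsDensity (P.map (LocalLimit.normalizedSum X n₀)) q ∧
          ∀ x, q x ≤ M) →
        -- the functions `z₀`, `λ`, `μ` are well defined in the disc `|τ| ≤ τ₀`, ...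
        (∀ τ : ℂ, ‖τ‖ ≤ c * α ^ 3 / (M ^ 2 * n₀) →
          ∃! z : ℂ, LocalLimit.IsSaddlePoint (X 0) P α τ z) ∧
        AnalyticOnNhd ℂ (LocalLimit.cramer (X 0) P α)
          (Metric.closedBall 0 (c * α ^ 3 / (M ^ 2 * n₀))) ∧
        (∀ τ : ℂ, ‖τ‖ ≤ c * α ^ 3 / (M ^ 2 * n₀) →
          HasSum (fun k : ℕ => iteratedDeriv k (LocalLimit.cramer (X 0) P α) 0 /
            (k.factorial : ℂ) * τ ^ k) (LocalLimit.cramer (X 0) P α τ)) ∧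
        AnalyticOnNhd ℂ (LocalLimit.muFun (X 0) P α)
          (Metric.closedBall 0 (c * α ^ 3 / (M ^ 2 * n₀))) ∧
        LocalLimit.muFun (X 0) P α 0 = 0 ∧
        -- ... and the continuous bounded density of `Z_n` has the stated representation
        ∀ n : ℕ, C * M ^ 4 * (n₀ : ℝ) ^ 2 / α ^ 12 ≤ (n : ℝ) →
          ∃ p : ℝ → ℝ, LocalLimit.IsDensity (P.map (LocalLimit.normalizedSum X n)) p ∧
            Continuous p ∧ (∃ D : ℝ, ∀ x, p x ≤ D) ∧
            ∀ x τ : ℝ, τ = x / Real.sqrt n → |τ| ≤ c * α ^ 3 / (M ^ 2 * n₀) →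
              ∃ B : ℝ, |B| ≤ C ∧
                ((p x / gaussianPDFReal 0 1 x : ℝ) : ℂ) =
                  Complex.exp ((n : ℂ) * (τ : ℂ) ^ 3 * LocalLimit.cramer (X 0) P α τ
                      - LocalLimit.muFun (X 0) P α τ) *
                    ((1 + B / α ^ 6 * (Real.log n ^ 3 / n) : ℝ) : ℂ) := by
  have hg := LocalLimit.gaussMoment_nonneg
  refine ⟨2 ^ 20 * LocalLimit.gaussMoment + 10 ^ 22, 1 / 2000, by positivity, by norm_num, ?_⟩
  intro Ω _ P _ X α M n₀ hind hid h0 h1 hα hi h2 hn₀ hq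
  have hS := LocalLimit.IsStandardized.of_variance_eq_one (hid 0).aemeasurable_fst h0 h1 hα hi h2
  have hX : LocalLimit.IsIIDWithDensity X P α M n₀ := ⟨hS, hind, hid, hn₀, hq⟩
  have hr := hX.radius_lt
  have hsub : Metric.closedBall (0 : ℂ) (1 / 2000 * α ^ 3 / (M ^ 2 * n₀)) ⊆
      Metric.ball 0 (α ^ 3 / 32) := Metric.closedBall_subset_ball hr
  refine ⟨fun τ hτ => hS.existsUnique_isSaddlePoint (by linarith),
    (hS.differentiableOn_cramer.analyticOnNhd Metric.isOpen_ball).mono hsub, fun τ hτ => ?_,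
    (hS.differentiableOn_muFun.analyticOnNhd Metric.isOpen_ball).mono hsub, hS.muFun_zero,
    fun n hn => ?_⟩
  · have := Complex.hasSum_taylorSeries_on_ball hS.differentiableOn_cramer
      (hsub (mem_closedBall_zero_iff.2 hτ))
    convert! this using 2 with k
    simp only [sub_zero, smul_eq_mul]
    ring
  · have hM := hX.three_sixteenths_le
    have hn' : 10 ^ 22 * M ^ 4 * (n₀ : ℝ) ^ 2 / α ^ 12 ≤ n := by
      refine le_trans ?_ hn
      gcongr
      linarith
    obtain ⟨hn4, -, -⟩ := hX.size_bounds hn'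
    have hn0 : (0 : ℝ) < n := by exact_mod_cast (by omega : 0 < n)
    obtain ⟨p, hp, hpc, hD⟩ := hX.exists_continuous_density hn4
    refine ⟨p, hp, hpc, hD, fun x τ hx hτ => ?_⟩
    obtain ⟨ρ, hρ, hpρ⟩ := hX.exists_div_gaussian_eq hn' hp hpc hτ
    have hxτ : √(n : ℝ) * τ = x := by
      rw [hx, mul_div_cancel₀]; exact (Real.sqrt_pos.2 hn0).ne'
    rw [hxτ] at hpρ
    -- the expansion holds even without the factor `(log n) ^ 3`, which is at least `1`
    have hlog : 1 ≤ Real.log n := by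
      rw [Real.le_log_iff_exp_le hn0]
      have : (3 : ℝ) ≤ n := by exact_mod_cast (by omega : 3 ≤ n)
      linarith [Real.exp_one_lt_d9]
    have hlog3 : 1 ≤ Real.log n ^ 3 := one_le_pow₀ hlog
    refine ⟨(ρ - 1) * (α ^ 6 * n) / Real.log n ^ 3, ?_, ?_⟩
    · rw [abs_div, abs_mul, abs_of_pos (by positivity : 0 < α ^ 6 * (n : ℝ)),
        abs_of_pos (by linarith : 0 < Real.log n ^ 3)]
      rw [le_div_iff₀ (by positivity)] at hρ
      exact (div_le_self (by positivity) hlog3).trans (by linarith)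
    · rw [hpρ]
      congr 2
      field_simp
      ring
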